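/- Let $a,\rho>0$ and let $\omega_{a,\rho}=\nu_{a,\rho}\otimes dy$ be the measure on the closed right half-plane $\overline{\mathcal R}=\{z=x+iy: x\ge 0\}$ with $\nu_{a,\rho}=\sum_{n\ge 0}\frac{a^n}{n!}\,\delta_{\rho n/2}$, so that $$\|F\|_{L^p(\omega_{a,\rho})}^p=\sum_{n=0}^{\infty}\frac{a^n}{n!}\int_{\mathbb R}\bigl|F\bigl(\tfrac{\rho n}{2}+iy\bigr)\bigr|^p\,dy .$$ For $1\le p<\infty$ let $\mathcal M^p_{a,\rho}$ be the space of functions $f$ holomorphic on $\mathcal R=\{\operatorname{Re}z>0\}$ with $\sup_{0<x<b}\int_{\mathbb R}|f(x+iy)|^p\,dy<\infty$ for every $b>0$ which, extended to the imaginary axis by their boundary values in $L^p(dy)$ (the limit of $f(x+i\,\cdot)$ in $L^p(dy)$ as $x\to0^+$), belong to $L^p(\overline{\mathcal R},d\omega_{a,\rho})$; it is regarded as a subspace of $L^p(\overline{\mathcal R},d\omega_{a,\rho})$, with the norm of that space. Then the orthogonal projection $P$ of $L^2(\overline{\mathcal R},d\omega_{a,\rho})$ onto $\mathcal M^2_{a,\rho}$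 exists, and for every $1\le p<\infty$ with $p\ne 2$ it is unbounded as an operator $$P:L^p(\overline{\mathcal R},d\omega_{a,\rho})\cap L^2(\overline{\mathcal R},d\omega_{a,\rho})\to\mathcal M^p_{a,\rho}.$$ That is, there is no constant $C$ such that $Pf\in\mathcal M^p_{a,\rho}$ and $\|Pf\|_{L^p(\omega_{a,\rho})}\le C\|f\|_{L^p(\omega_{a,\rho})}$ for all $f\in L^p\cap L^2$; moreover, for every $C\ge0$ there is $f\in L^p\cap L^2$ with $\|Pf\|_{L^p(\omega_{a,\rho})}>C\|f\|_{L^p(\omega_{a,\rho})}$, where the left-hand side is $+\infty$ if $Pf\notin L^p(\omega_{a,\rho})$. -/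

import Mathlib

open MeasureTheory Filter Topology Set
open scoped ENNReal NNReal

namespace HardyBergman

/-- The purely atomic measure `ν_{a,ρ} = ∑_{n ≥ 0} (a ^ n / n!) δ_{ρ n / 2}` on the real line,
carried by `[0, +∞)` when `ρ > 0`. -/
noncomputable def nu (a ρ : ℝ) : Measure ℝ :=
  Measure.sum fun n : ℕ =>
    ENNReal.ofReal (a ^ n / (n.factorial : ℝ)) • Measure.dirac (ρ * (n : ℝ) / 2)

/-- The translation invariant measure `ω_{a,ρ} = ν_{a,ρ}(x) ⊗ dy`, as a measure on `ℂ`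
(with `z = x + i y`). It is carried by the closed right half-plane, so that `L^p(ℂ, ω_{a,ρ})` is
the same as `L^p` of the closed right half-plane. -/
noncomputable def omega (a ρ : ℝ) : Measure ℂ :=
  ((nu a ρ).prod (volume : Measure ℝ)).map Complex.measurableEquivRealProd.symm

/-- The function `y ↦ f (x + i y)`. -/
noncomputable def onLine (f : ℂ → ℂ) (x : ℝ) : ℝ → ℂ :=
  fun y => f ((x : ℂ) + (y : ℂ) * Complex.I)

/-- The Hardy space `H^p` of the strip `c < Re z < d`: holomorphic functions on the strip whose
`L^p` norms on the vertical lines inside the strip are bounded. -/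
def MemHardyStrip (p : ℝ≥0∞) (c d : ℝ) (f : ℂ → ℂ) : Prop :=
  DifferentiableOn ℂ f {z : ℂ | c < z.re ∧ z.re < d} ∧
    ⨆ x ∈ Ioo c d, eLpNorm (onLine f x) p volume < ⊤

/-- `g` is the boundary value function of `f` on the imaginary axis, in `L^p(dy)`:
`f (x + i ·) → g` in `L^p(dy)` as `x → 0+`. -/
def HasBoundaryValues (p : ℝ≥0∞) (f : ℂ → ℂ) (g : ℝ → ℂ) : Prop :=
  MemLp g p volume ∧
    Tendsto (fun x : ℝ => eLpNorm (onLine f x - g) p volume) (𝓝[>] 0) (𝓝 0)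

/-- Membership in the generalized Hardy--Bergman space `M^p_{a,ρ}`, seen inside
`L^p(ω_{a,ρ})`: `F` is in `L^p(ω_{a,ρ})`, it agrees `ω_{a,ρ}`-almost everywhere in the open right
half-plane with a holomorphic function `f` that belongs to `H^p` of all strips `0 < Re z < b`,
and on the imaginary axis it is the boundary value function of `f`. -/
def MemM (a ρ : ℝ) (p : ℝ≥0∞) (F : ℂ → ℂ) : Prop :=
  MemLp F p (omega a ρ) ∧
    ∃ f : ℂ → ℂ,
      DifferentiableOn ℂ f {z : ℂ | 0 < z.re} ∧
      (∀ b : ℝ, 0 < b → MemHardyStrip p 0 b f) ∧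
      (∀ᵐ z ∂(omega a ρ), 0 < z.re → F z = f z) ∧
      HasBoundaryValues p f (onLine F 0)

/-- Integration against `ω_{a,ρ}`. -/
theorem lintegral_omega (a ρ : ℝ) (g : ℂ → ℝ≥0∞) (hg : Measurable g) :
    ∫⁻ z, g z ∂(omega a ρ) =
      ∑' n : ℕ, ENNReal.ofReal (a ^ n / (n.factorial : ℝ)) *
        ∫⁻ y : ℝ, g (((ρ * (n : ℝ) / 2 : ℝ) : ℂ) + (y : ℂ) * Complex.I) := by
  have h1 : Measurable fun q : ℝ × ℝ => g (Complex.measurableEquivRealProd.symm q) :=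
    hg.comp (MeasurableEquiv.measurable _)
  have e : ∀ x y : ℝ, Complex.measurableEquivRealProd.symm (x, y)
      = (x : ℂ) + (y : ℂ) * Complex.I := by
    intro x y
    apply Complex.ext <;> simp
  have : SFinite (nu a ρ) := by unfold nu; infer_instance
  rw [omega, lintegral_map hg (MeasurableEquiv.measurable _), lintegral_prod _ h1.aemeasurable, nu,
    lintegral_sum_measure]
  refine tsum_congr fun n => ?_
  rw [lintegral_smul_measure, lintegral_dirac' _ h1.lintegral_prod_right', smul_eq_mul]
  simp only [e]

/-- An `ω_{a,ρ}`-null condition is a `dy`-null condition on the imaginary axis. -/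
theorem ae_axis (a ρ : ℝ) {q : ℂ → Prop} (h : ∀ᵐ z ∂(omega a ρ), q z) :
    ∀ᵐ y : ℝ, q (((0 : ℝ) : ℂ) + (y : ℂ) * Complex.I) := by
  obtain ⟨s, hs, hsm, hs0⟩ := exists_measurable_superset_of_null (ae_iff.1 h)
  have h0 : ∫⁻ z, s.indicator 1 z ∂(omega a ρ) = 0 := by
    rw [lintegral_indicator_one hsm, hs0]
  rw [lintegral_omega a ρ _ (measurable_one.indicator hsm), ENNReal.tsum_eq_zero] at h0
  have h1 := h0 0
  have hm : Measurable fun y : ℝ =>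
      s.indicator (1 : ℂ → ℝ≥0∞) (((0 : ℝ) : ℂ) + (y : ℂ) * Complex.I) :=
    (measurable_one.indicator hsm).comp (by fun_prop)
  simp only [pow_zero, Nat.factorial_zero, Nat.cast_one, div_one, ENNReal.ofReal_one, one_mul,
    Nat.cast_zero, mul_zero, zero_div] at h1
  rw [lintegral_eq_zero_iff hm] at h1
  filter_upwards [h1] with y hy
  by_contra hc
  have : (((0 : ℝ) : ℂ) + (y : ℂ) * Complex.I) ∈ s := hs hc
  rw [indicator_of_mem this] at hy
  exact one_ne_zero hy

theorem continuous_onLine {f : ℂ → ℂ} (hf : DifferentiableOn ℂ f {z : ℂ | 0 < z.re})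
    {x : ℝ} (hx : 0 < x) : Continuous (onLine f x) :=
  hf.continuousOn.comp_continuous (by fun_prop) (fun y => by simpa using hx)

theorem MemHardyStrip.add {p : ℝ≥0∞} (hp : 1 ≤ p) {b : ℝ} {f g : ℂ → ℂ}
    (hf' : DifferentiableOn ℂ f {z : ℂ | 0 < z.re})
    (hg' : DifferentiableOn ℂ g {z : ℂ | 0 < z.re})
    (hf : MemHardyStrip p 0 b f) (hg : MemHardyStrip p 0 b g) :
    MemHardyStrip p 0 b (f + g) := by
  refine ⟨hf.1.add hg.1, lt_of_le_of_lt ?_ (ENNReal.add_lt_top.2 ⟨hf.2, hg.2⟩)⟩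
  refine iSup₂_le fun x hx => ?_
  refine (eLpNorm_add_le (f := onLine f x) (g := onLine g x)
    (continuous_onLine hf' hx.1).aestronglyMeasurable
    (continuous_onLine hg' hx.1).aestronglyMeasurable hp).trans ?_
  exact add_le_add (le_iSup₂ (f := fun x (_ : x ∈ Ioo 0 b) => eLpNorm (onLine f x) p volume) x hx)
    (le_iSup₂ (f := fun x (_ : x ∈ Ioo 0 b) => eLpNorm (onLine g x) p volume) x hx)

theorem MemHardyStrip.const_smul {p : ℝ≥0∞} {b : ℝ} {f : ℂ → ℂ} (c : ℂ)
    (hf : MemHardyStrip p 0 b f) : MemHardyStrip p 0 b (c • f) := by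
  refine ⟨hf.1.const_smul c,
    lt_of_le_of_lt ?_ (ENNReal.mul_lt_top (enorm_lt_top (x := c)) hf.2)⟩
  refine iSup₂_le fun x hx => ?_
  have : onLine (c • f) x = c • onLine f x := rfl
  rw [this, eLpNorm_const_smul]
  gcongr
  exact le_iSup₂ (f := fun x (_ : x ∈ Ioo 0 b) => eLpNorm (onLine f x) p volume) x hx

/-- The space `M^p_{a,ρ}` as a linear subspace of `L^p(ω_{a,ρ})`; its norm is the norm of
`L^p(ω_{a,ρ})`. -/
noncomputable def M (a ρ : ℝ) (p : ℝ≥0∞) [hp : Fact (1 ≤ p)] :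
    Submodule ℂ (Lp ℂ p (omega a ρ)) where
  carrier := {F | MemM a ρ p F}
  zero_mem' := by
    have h0 := Lp.coeFn_zero ℂ p (omega a ρ)
    have hz : onLine (⇑(0 : Lp ℂ p (omega a ρ))) 0 =ᵐ[volume] 0 := ae_axis a ρ h0
    refine ⟨Lp.memLp _, 0, differentiableOn_const 0, fun b _ => ⟨differentiableOn_const 0, ?_⟩, ?_,
      (memLp_congr_ae hz).2 MemLp.zero, ?_⟩
    · have : ∀ x, onLine (0 : ℂ → ℂ) x = 0 := fun _ => rfl
      simp [this]
    · filter_upwards [h0] with z hz _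
      exact hz
    · refine tendsto_const_nhds.congr fun x => ?_
      have : onLine 0 x - onLine (⇑(0 : Lp ℂ p (omega a ρ))) 0 =ᵐ[volume] (0 : ℝ → ℂ) := by
        filter_upwards [hz] with y hy
        rw [Pi.sub_apply, hy]
        simp [onLine]
      rw [eLpNorm_congr_ae this, eLpNorm_zero]
  add_mem' := by
    rintro F G ⟨-, f, hfd, hfH, hfe, hfm, hft⟩ ⟨-, g, hgd, hgH, hge, hgm, hgt⟩
    have h0 := Lp.coeFn_add F G
    have hz : onLine (⇑(F + G)) 0 =ᵐ[volume] onLine F 0 + onLine G 0 := ae_axis a ρ h0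
    refine ⟨Lp.memLp _, f + g, hfd.add hgd, fun b hb => (hfH b hb).add hp.out hfd hgd (hgH b hb),
      ?_, (memLp_congr_ae hz).2 (hfm.add hgm), ?_⟩
    · filter_upwards [h0, hfe, hge] with z h1 h2 h3 hz
      rw [h1, Pi.add_apply, Pi.add_apply, h2 hz, h3 hz]
    · have hs := hft.add hgt
      rw [add_zero] at hs
      refine tendsto_of_tendsto_of_tendsto_of_le_of_le' tendsto_const_nhds hs
        (Eventually.of_forall fun _ => zero_le) ?_
      filter_upwards [self_mem_nhdsWithin] with x hx
      have : onLine (f + g) x - onLine (⇑(F + G)) 0 =ᵐ[volume]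
          (onLine f x - onLine F 0) + (onLine g x - onLine G 0) := by
        filter_upwards [hz] with y hy
        simp only [Pi.sub_apply, Pi.add_apply, hy]
        simp only [onLine, Pi.add_apply]
        ring
      rw [eLpNorm_congr_ae this]
      exact eLpNorm_add_le
        ((continuous_onLine hfd hx).aestronglyMeasurable.sub hfm.aestronglyMeasurable)
        ((continuous_onLine hgd hx).aestronglyMeasurable.sub hgm.aestronglyMeasurable) hp.out
  smul_mem' := by
    rintro c F ⟨-, f, hfd, hfH, hfe, hfm, hft⟩
    have h0 := Lp.coeFn_smul c F
    have hz : onLine (⇑(c • F)) 0 =ᵐ[volume] c • onLine F 0 := ae_axis a ρ h0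
    refine ⟨Lp.memLp _, c • f, hfd.const_smul c, fun b hb => (hfH b hb).const_smul c,
      ?_, (memLp_congr_ae hz).2 (hfm.const_smul c), ?_⟩
    · filter_upwards [h0, hfe] with z h1 h2 hz
      rw [h1, Pi.smul_apply, Pi.smul_apply, h2 hz]
    · have hs := ENNReal.Tendsto.const_mul (a := ‖c‖ₑ) hft (Or.inr enorm_ne_top)
      rw [mul_zero] at hs
      refine hs.congr fun x => ?_
      have : onLine (c • f) x - onLine (⇑(c • F)) 0 =ᵐ[volume]
          c • (onLine f x - onLine F 0) := by
        filter_upwards [hz] with y hy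
        simp only [Pi.sub_apply, Pi.smul_apply, hy, smul_sub]
        rfl
      rw [eLpNorm_congr_ae this, eLpNorm_const_smul]

end HardyBergman

/-!
By a Paley–Wiener theorem, an element `F` of `M²` is determined by the Fourier transform `g` of its
boundary values: the Fourier transform of `F (x + i ·)` is `exp (2 π x ξ) g ξ`
(`inner_fourier_onLine`; it follows from Cauchy's theorem, by moving a vertical line of
integration), and conversely such a family of functions on the lines `Re z = ρ n / 2` which is in
`L²(ω_{a,ρ})` comes from the Laplace transform of `g` (`memM_of_tilt`). Hence `M²` is cut out of `L²(ω_{a,ρ})` by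
continuous linear equations; it is closed (`isClosed_M`) and the projection `P` exists.

With `c n = a ^ n / n!`, the square of the norm of `F` is `∑ c n ∫ exp (2 π ρ n ξ) |g ξ|² dξ =
∫ exp (a exp (2 π ρ ξ)) |g ξ|² dξ`. It follows that, from the `n`-th line to the `m`-th one, `P` is
the Fourier multiplier `c n * exp (π ρ (n + m) ξ) * exp (-a exp (2 π ρ ξ))`
(`onLine_starProjection`).

A bound `C` for `P` in `L^p` bounds the modulus of these multipliers at each frequency: testing on
functions whose Fourier transform concentrates at `ξ` gives, with `t = exp (2 π ρ ξ)`,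
`(c m) ^ (1 / p) * (c n) ^ (1 - 1 / p) * t ^ ((n + m) / 2) * exp (-a t) ≤ C`
(`multiplier_le_of_bounded`). Taking `t = N` and `(n, m) = (0, N)` when `p > 2`, or
`(n, m) = (N, 0)` when `p < 2`, the left-hand side is at least `(const * N ^ (1 / 2 - θ)) ^ N` with
`θ = 1 / p`, respectively `θ = 1 - 1 / p`, so `θ < 1 / 2` and it tends to infinity
(`exists_lt_coeff_rpow_mul`).
-/

namespace HardyBergman

/-! ### The Fourier transform on `L¹ ∩ L²` -/

open FourierTransform SchwartzMap in
theorem integral_fourierInv_mul_eq {f g : ℝ → ℂ} (hf : Integrable f) (hg : Integrable g) :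
    ∫ x, 𝓕⁻ f x * g x = ∫ x, f x * 𝓕⁻ g x := by
  have h := VectorFourier.integral_fourierIntegral_smul_eq_flip (L := -innerₗ ℝ)
    Real.continuous_fourierChar (by simpa using! continuous_inner.neg) hf hg
  have hflip : (-innerₗ ℝ : ℝ →ₗ[ℝ] ℝ →ₗ[ℝ] ℝ).flip = -innerₗ ℝ := by
    ext; simp
  rw [hflip] at h
  exact h

open FourierTransform in
theorem continuous_fourierInv {g : ℝ → ℂ} (hg : Integrable g) : Continuous (𝓕⁻ g) :=
  VectorFourier.fourierIntegral_continuous (L := -innerₗ ℝ) Real.continuous_fourierChar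
    (by simpa using! continuous_inner.neg) hg

open FourierTransform SchwartzMap in
/-- On `L¹ ∩ L²` the inverse Fourier transform of `L²` is given by the Fourier integral: both
have the same integral against Schwartz functions. -/
theorem coeFn_fourierInv_toLp {g : ℝ → ℂ} (h1 : Integrable g) (h2 : MemLp g 2 volume) :
    ⇑(𝓕⁻ (h2.toLp g) : Lp ℂ 2 (volume : Measure ℝ)) =ᵐ[volume] 𝓕⁻ g := by
  refine ae_eq_of_integral_contDiff_smul_eq
    ((Lp.memLp _).locallyIntegrable (by norm_num))
    (continuous_fourierInv h1).locallyIntegrable fun φ hφ hφc => ?_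
  have hc : HasCompactSupport fun x => (φ x : ℂ) := hφc.comp_left (g := fun x : ℝ => (x : ℂ)) rfl
  set Φ : 𝓢(ℝ, ℂ) := hc.toSchwartzMap (Complex.ofRealCLM.contDiff.comp hφ) with hΦ
  have hΦa : ∀ x, Φ x = (φ x : ℂ) := fun x => rfl
  have e := DFunLike.congr_fun (Lp.fourierInv_toTemperedDistribution_eq (h2.toLp g)) Φ
  rw [TemperedDistribution.fourierInv_apply, Lp.toTemperedDistribution_apply,
    Lp.toTemperedDistribution_apply] at e
  have e1 : ∫ x, (𝓕⁻ Φ) x • (h2.toLp g) x = ∫ x, 𝓕⁻ (⇑Φ) x * g x := by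
    refine integral_congr_ae ?_
    filter_upwards [h2.coeFn_toLp] with x hx
    rw [hx, SchwartzMap.fourierInv_coe, smul_eq_mul]
  rw [e1, integral_fourierInv_mul_eq Φ.integrable h1] at e
  simp only [Complex.real_smul]
  simp only [smul_eq_mul, hΦa] at e
  exact e.symm

open FourierTransform in
theorem memLp_fourierInv {g : ℝ → ℂ} (h1 : Integrable g) (h2 : MemLp g 2 volume) :
    MemLp (𝓕⁻ g) 2 volume :=
  (memLp_congr_ae (coeFn_fourierInv_toLp h1 h2)).1 (Lp.memLp _)

open FourierTransform in
/-- Plancherel's theorem for the Fourier integral of a function in `L¹ ∩ L²`. -/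
theorem eLpNorm_fourierInv {g : ℝ → ℂ} (h1 : Integrable g) (h2 : MemLp g 2 volume) :
    eLpNorm (𝓕⁻ g) 2 volume = eLpNorm g 2 volume := by
  have h := (Lp.fourierTransformₗᵢ ℝ ℂ).symm.norm_map (h2.toLp g)
  rw [Lp.norm_toLp, Lp.norm_def,
    ENNReal.toReal_eq_toReal_iff' (Lp.eLpNorm_ne_top _) h2.eLpNorm_ne_top] at h
  rw [← h]
  exact (eLpNorm_congr_ae (coeFn_fourierInv_toLp h1 h2)).symm

open FourierTransform in
/-- Parseval's formula, one of the functions being in `L¹ ∩ L²`. -/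
theorem integral_conj_fourierInv_mul {g u : ℝ → ℂ} (h1 : Integrable g) (h2 : MemLp g 2 volume)
    (hu : MemLp u 2 volume) :
    ∫ y, (starRingEnd ℂ) (𝓕⁻ g y) * u y =
      ∫ ξ, (starRingEnd ℂ) (g ξ) * (𝓕 (hu.toLp u) : Lp ℂ 2 (volume : Measure ℝ)) ξ := by
  have h := (Lp.fourierTransformₗᵢ ℝ ℂ).inner_map_map
    ((Lp.fourierTransformₗᵢ ℝ ℂ).symm (h2.toLp g)) (hu.toLp u)
  rw [LinearIsometryEquiv.apply_symm_apply, L2.inner_def, L2.inner_def] at h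
  calc _ = ∫ y, inner ℂ ((𝓕⁻ (h2.toLp g) : Lp ℂ 2 (volume : Measure ℝ)) y) (hu.toLp u y) := by
        refine integral_congr_ae ?_
        filter_upwards [coeFn_fourierInv_toLp h1 h2, hu.coeFn_toLp] with y h3 h4
        rw [h3, h4, RCLike.inner_apply, mul_comm]
    _ = _ := h.symm
    _ = _ := by
        refine integral_congr_ae ?_
        filter_upwards [h2.coeFn_toLp] with y h3
        rw [h3, RCLike.inner_apply, mul_comm]
        rfl

/-! ### Exponential weights and the Laplace transform -/

/-- The function `ξ ↦ exp (2 π x ξ) g ξ`. -/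
noncomputable def tilt (x : ℝ) (g : ℝ → ℂ) : ℝ → ℂ :=
  fun ξ => (Real.exp (2 * Real.pi * x * ξ) : ℂ) * g ξ

/-- The bilateral Laplace transform `z ↦ ∫ exp (2 π z ξ) g ξ dξ`, with the sign and the
normalization for which its restriction to a vertical line is an inverse Fourier transform. -/
noncomputable def laplace (g : ℝ → ℂ) (z : ℂ) : ℂ :=
  ∫ ξ : ℝ, Complex.exp (2 * Real.pi * z * ξ) * g ξ

theorem tilt_zero (g : ℝ → ℂ) : tilt 0 g = g := by
  ext ξ; simp [tilt]

theorem tilt_tilt (x y : ℝ) (g : ℝ → ℂ) : tilt x (tilt y g) = tilt (x + y) g := by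
  ext ξ
  simp only [tilt]
  rw [← mul_assoc, ← Complex.ofReal_mul, ← Real.exp_add]
  congr 3; ring

theorem norm_tilt (x : ℝ) (g : ℝ → ℂ) (ξ : ℝ) :
    ‖tilt x g ξ‖ = Real.exp (2 * Real.pi * x * ξ) * ‖g ξ‖ := by
  rw [tilt, norm_mul, Complex.norm_real, Real.norm_of_nonneg (Real.exp_pos _).le]

open FourierTransform in
theorem onLine_laplace (g : ℝ → ℂ) (x : ℝ) : onLine (laplace g) x = 𝓕⁻ (tilt x g) := by
  ext y
  rw [Real.fourierInv_eq', onLine, laplace]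
  refine integral_congr_ae (Eventually.of_forall fun ξ => ?_)
  simp only [tilt, smul_eq_mul]
  rw [← mul_assoc, Complex.ofReal_exp, ← Complex.exp_add]
  congr 2
  simp
  ring

theorem aestronglyMeasurable_tilt {x : ℝ} {g : ℝ → ℂ} (hg : AEStronglyMeasurable g volume) :
    AEStronglyMeasurable (tilt x g) volume :=
  (Continuous.aestronglyMeasurable (by fun_prop)).mul hg

theorem aestronglyMeasurable_of_tilt {x y : ℝ} {g : ℝ → ℂ}
    (hg : AEStronglyMeasurable (tilt x g) volume) : AEStronglyMeasurable (tilt y g) volume := by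
  have := aestronglyMeasurable_tilt (x := y - x) hg
  rwa [tilt_tilt, sub_add_cancel] at this

theorem exp_le_exp_add_exp {α x β : ℝ} (h1 : α ≤ x) (h2 : x ≤ β) (ξ : ℝ) :
    Real.exp (2 * Real.pi * x * ξ) ≤
      Real.exp (2 * Real.pi * α * ξ) + Real.exp (2 * Real.pi * β * ξ) := by
  have hpi := Real.pi_pos
  rcases le_total 0 ξ with h | h
  · refine le_add_of_nonneg_of_le (Real.exp_pos _).le (Real.exp_le_exp.2 ?_)
    gcongr
  · refine le_add_of_le_of_nonneg (Real.exp_le_exp.2 ?_) (Real.exp_pos _).le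
    refine mul_le_mul_of_nonpos_right ?_ h
    gcongr

theorem norm_tilt_le {α x β : ℝ} (h1 : α ≤ x) (h2 : x ≤ β) (g : ℝ → ℂ) (ξ : ℝ) :
    ‖tilt x g ξ‖ ≤ ‖tilt α g ξ‖ + ‖tilt β g ξ‖ := by
  simp only [norm_tilt, ← add_mul]
  exact mul_le_mul_of_nonneg_right (exp_le_exp_add_exp h1 h2 ξ) (norm_nonneg _)

theorem memLp_tilt {p : ℝ≥0∞} {α x β : ℝ} (h1 : α ≤ x) (h2 : x ≤ β) {g : ℝ → ℂ}
    (hα : MemLp (tilt α g) p volume) (hβ : MemLp (tilt β g) p volume) :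
    MemLp (tilt x g) p volume :=
  (hα.norm.add hβ.norm).of_le (aestronglyMeasurable_of_tilt hα.1) (Eventually.of_forall fun ξ => by
    rw [Pi.add_apply, Real.norm_of_nonneg (by positivity)]
    exact norm_tilt_le h1 h2 g ξ)

theorem eLpNorm_tilt_le {α x β : ℝ} (h1 : α ≤ x) (h2 : x ≤ β) {g : ℝ → ℂ}
    (hα : MemLp (tilt α g) 2 volume) (hβ : MemLp (tilt β g) 2 volume) :
    eLpNorm (tilt x g) 2 volume ≤ eLpNorm (tilt α g) 2 volume + eLpNorm (tilt β g) 2 volume := by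
  calc eLpNorm (tilt x g) 2 volume
      ≤ eLpNorm ((fun ξ => ‖tilt α g ξ‖) + fun ξ => ‖tilt β g ξ‖) 2 volume :=
        eLpNorm_mono_real (norm_tilt_le h1 h2 g)
    _ ≤ eLpNorm (fun ξ => ‖tilt α g ξ‖) 2 volume + eLpNorm (fun ξ => ‖tilt β g ξ‖) 2 volume :=
        eLpNorm_add_le hα.1.norm hβ.1.norm (by norm_num)
    _ = _ := by rw [eLpNorm_norm, eLpNorm_norm]

theorem memLp_two_inv_one_add_sq : MemLp (fun x : ℝ => (1 + x ^ 2)⁻¹) 2 volume := by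
  have hm : AEStronglyMeasurable (fun x : ℝ => (1 + x ^ 2)⁻¹) volume :=
    integrable_inv_one_add_sq.aestronglyMeasurable
  rw [memLp_two_iff_integrable_sq hm]
  refine integrable_inv_one_add_sq.mono (hm.pow 2) (Eventually.of_forall fun x => ?_)
  have h1 : 0 ≤ (1 + x ^ 2)⁻¹ := by positivity
  have h2 : (1 + x ^ 2)⁻¹ ≤ 1 := inv_le_one_of_one_le₀ (by nlinarith [sq_nonneg x])
  rw [Real.norm_of_nonneg (by positivity), Real.norm_of_nonneg h1]
  nlinarith

/-- Between two exponential weights for which `g` is square integrable, `g` is integrable: the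
geometric mean of the two weights is smaller than their sum by a factor `1 / cosh`, which is square
integrable. -/
theorem integrable_tilt {α x β : ℝ} (h1 : α < x) (h2 : x < β) {g : ℝ → ℂ}
    (hα : MemLp (tilt α g) 2 volume) (hβ : MemLp (tilt β g) 2 volume) :
    Integrable (tilt x g) := by
  obtain ⟨δ, hδ, hδ1, hδ2⟩ : ∃ δ > 0, α ≤ x - δ ∧ x + δ ≤ β :=
    ⟨min (x - α) (β - x), by simp [h1, h2], by linarith [min_le_left (x - α) (β - x)],
      by linarith [min_le_right (x - α) (β - x)]⟩
  have hpi := Real.pi_pos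
  set c : ℝ := Real.pi * δ with hc
  have hc0 : 0 < c := by positivity
  have hk : MemLp (fun ξ : ℝ => (1 + (c * ξ) ^ 2)⁻¹) 2 volume := by
    have h := memLp_two_inv_one_add_sq
    have h3 : MemLp (fun x : ℝ => (1 + x ^ 2)⁻¹) 2 (Measure.map (fun x => c * x) volume) := by
      rw [Real.map_volume_mul_left hc0.ne']
      exact h.smul_measure ENNReal.ofReal_ne_top
    exact h3.comp_of_map (by fun_prop)
  have hm : MemLp (tilt (x - δ) g) 2 volume :=
    memLp_tilt hδ1 (by linarith) hα hβ
  have hp : MemLp (tilt (x + δ) g) 2 volume :=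
    memLp_tilt (by linarith) hδ2 hα hβ
  have hi : Integrable (fun ξ => (1 + (c * ξ) ^ 2)⁻¹ *
      (‖tilt (x - δ) g ξ‖ + ‖tilt (x + δ) g ξ‖)) := hk.integrable_mul (hm.norm.add hp.norm)
  refine hi.mono' (aestronglyMeasurable_of_tilt hα.1) (Eventually.of_forall fun ξ => ?_)
  simp only [norm_tilt, ← add_mul]
  rw [← mul_assoc]
  refine mul_le_mul_of_nonneg_right ?_ (norm_nonneg _)
  rw [le_inv_mul_iff₀ (by positivity)]
  have e1 : Real.exp (2 * Real.pi * (x - δ) * ξ) =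
      Real.exp (2 * Real.pi * x * ξ) * Real.exp (-(2 * c * ξ)) := by
    rw [← Real.exp_add]; congr 1; rw [hc]; ring
  have e2 : Real.exp (2 * Real.pi * (x + δ) * ξ) =
      Real.exp (2 * Real.pi * x * ξ) * Real.exp (2 * c * ξ) := by
    rw [← Real.exp_add]; congr 1; rw [hc]; ring
  rw [e1, e2, ← mul_add, mul_comm]
  refine mul_le_mul_of_nonneg_left ?_ (Real.exp_pos _).le
  -- `1 + t ^ 2 ≤ 2 cosh (2 t)`, because `|t| ≤ |exp t - exp (-t)|`
  have h4 : ∀ t : ℝ, 1 + t ^ 2 ≤ Real.exp (-(2 * t)) + Real.exp (2 * t) := fun t => by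
    have e : Real.exp (-(2 * t)) + Real.exp (2 * t)
        = Real.exp (-t) ^ 2 + Real.exp t ^ 2 := by
      rw [← Real.exp_nat_mul, ← Real.exp_nat_mul]; congr 2; push_cast; ring
    have h5 : Real.exp (-t) * Real.exp t = 1 := by rw [← Real.exp_add]; simp
    have h6 : |t| ≤ |Real.exp t - Real.exp (-t)| := by
      rcases le_total 0 t with h | h
      · rw [abs_of_nonneg h, abs_of_nonneg (by
          rw [sub_nonneg, Real.exp_le_exp]; linarith)]
        nlinarith [Real.add_one_le_exp t, Real.exp_le_one_iff.2 (neg_nonpos.2 h)]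
      · rw [abs_of_nonpos h, abs_of_nonpos (by
          rw [sub_nonpos, Real.exp_le_exp]; linarith)]
        nlinarith [Real.add_one_le_exp (-t), Real.exp_le_one_iff.2 h]
    have h7 := sq_le_sq.2 h6
    rw [e]; nlinarith
  have := h4 (c * ξ)
  rwa [← mul_assoc] at this

/-- The Laplace transform is holomorphic in the open strip between two lines of absolute
convergence. -/
theorem differentiableAt_laplace {α β : ℝ} {z : ℂ} (h1 : α < z.re) (h2 : z.re < β) {g : ℝ → ℂ}
    (hα : Integrable (tilt α g)) (hβ : Integrable (tilt β g)) :
    DifferentiableAt ℂ (laplace g) z := by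
  obtain ⟨δ, hδ, hδ1, hδ2⟩ : ∃ δ > 0, α + 2 * δ ≤ z.re ∧ z.re + 2 * δ ≤ β :=
    ⟨min (z.re - α) (β - z.re) / 2, by simp [h1, h2],
      by linarith [min_le_left (z.re - α) (β - z.re)],
      by linarith [min_le_right (z.re - α) (β - z.re)]⟩
  have hpi := Real.pi_pos
  have hgm : AEStronglyMeasurable g volume := by
    have := aestronglyMeasurable_of_tilt (y := 0) hα.aestronglyMeasurable
    rwa [tilt_zero] at this
  have hnorm : ∀ (w : ℂ) (ξ : ℝ), ‖Complex.exp (2 * Real.pi * w * ξ) * g ξ‖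
      = ‖tilt w.re g ξ‖ := fun w ξ => by
    rw [norm_tilt, norm_mul, Complex.norm_exp]
    congr 2
    simp
  have hbd : Integrable fun ξ => δ⁻¹ * (2 * (‖tilt α g ξ‖ + ‖tilt β g ξ‖)) :=
    ((hα.norm.add hβ.norm).const_mul _).const_mul _
  refine (hasDerivAt_integral_of_dominated_loc_of_deriv_le
    (F := fun w (ξ : ℝ) => Complex.exp (2 * Real.pi * w * ξ) * g ξ)
    (F' := fun w (ξ : ℝ) => 2 * Real.pi * ξ * (Complex.exp (2 * Real.pi * w * ξ) * g ξ))
    (Metric.ball_mem_nhds z hδ) (Eventually.of_forall fun w => ?_) ?_ ?_ ?_ hbd ?_).2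
    |>.differentiableAt
  · exact (Continuous.aestronglyMeasurable (by fun_prop)).mul hgm
  · refine (hα.norm.add hβ.norm).mono'
      ((Continuous.aestronglyMeasurable (by fun_prop)).mul hgm) (Eventually.of_forall fun ξ => ?_)
    rw [hnorm]
    exact norm_tilt_le h1.le h2.le g ξ
  · exact (Continuous.aestronglyMeasurable (by fun_prop)).mul
      ((Continuous.aestronglyMeasurable (by fun_prop)).mul hgm)
  · refine Eventually.of_forall fun ξ w hw => ?_
    have hw' : |w.re - z.re| ≤ δ := by
      have := (Complex.abs_re_le_norm (w - z)).trans (mem_ball_iff_norm.1 hw).le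
      simpa using this
    obtain ⟨hw1, hw2⟩ := abs_le.1 hw'
    rw [norm_mul, hnorm]
    have e : ‖(2 * Real.pi * ξ : ℂ)‖ = 2 * Real.pi * |ξ| := by
      simp [abs_of_pos hpi]
    rw [e]
    -- the polynomial factor is absorbed by widening the strip by `δ` on each side
    have h5 : δ * (2 * Real.pi * |ξ|) ≤
        Real.exp (2 * Real.pi * (-δ) * ξ) + Real.exp (2 * Real.pi * δ * ξ) := by
      rcases le_total 0 ξ with h | h
      · rw [abs_of_nonneg h]
        nlinarith [Real.add_one_le_exp (2 * Real.pi * δ * ξ),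
          Real.exp_pos (2 * Real.pi * (-δ) * ξ)]
      · rw [abs_of_nonpos h]
        nlinarith [Real.add_one_le_exp (2 * Real.pi * (-δ) * ξ),
          Real.exp_pos (2 * Real.pi * δ * ξ)]
    rw [le_inv_mul_iff₀ hδ, ← mul_assoc]
    refine (mul_le_mul_of_nonneg_right h5 (norm_nonneg _)).trans ?_
    have h6 := norm_tilt_le (α := α) (x := -δ + w.re) (β := β) (by linarith) (by linarith) g ξ
    have h7 := norm_tilt_le (α := α) (x := δ + w.re) (β := β) (by linarith) (by linarith) g ξ
    rw [← tilt_tilt, norm_tilt] at h6 h7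
    rw [add_mul]
    linarith
  · refine Eventually.of_forall fun ξ w _ => ?_
    have h : HasDerivAt (fun w : ℂ => Complex.exp (2 * Real.pi * w * ξ))
        (Complex.exp (2 * Real.pi * w * ξ) * (2 * Real.pi * 1 * ξ)) w :=
      (((hasDerivAt_id w).const_mul (2 * Real.pi : ℂ)).mul_const (ξ : ℂ)).cexp
    convert! h.mul_const (g ξ) using 1
    ring

theorem tendsto_eLpNorm_tilt_sub {α x₀ β : ℝ} (h1 : α ≤ x₀) (h2 : x₀ ≤ β) {g : ℝ → ℂ}
    (hα : MemLp (tilt α g) 2 volume) (hβ : MemLp (tilt β g) 2 volume) :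
    Tendsto (fun x => eLpNorm (tilt x g - tilt x₀ g) 2 volume) (𝓝[Icc α β] x₀) (𝓝 0) := by
  have hm : ∀ x, AEStronglyMeasurable (tilt x g) volume := fun x =>
    aestronglyMeasurable_of_tilt hα.1
  have hb : MemLp (fun ξ => 2 * (‖tilt α g ξ‖ + ‖tilt β g ξ‖)) 2 volume :=
    (hα.norm.add hβ.norm).const_mul 2
  have key : Tendsto (fun x => ∫⁻ ξ, ‖(tilt x g - tilt x₀ g) ξ‖ₑ ^ (2 : ℝ)) (𝓝[Icc α β] x₀)
      (𝓝 (∫⁻ _ξ : ℝ, 0)) := by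
    refine tendsto_lintegral_filter_of_dominated_convergence'
      (fun ξ => ‖2 * (‖tilt α g ξ‖ + ‖tilt β g ξ‖)‖ₑ ^ (2 : ℝ))
      (Eventually.of_forall fun x => (((hm x).sub (hm x₀)).enorm.pow_const _)) ?_ ?_ ?_
    · filter_upwards [self_mem_nhdsWithin] with x hx
      refine Eventually.of_forall fun ξ => ?_
      refine ENNReal.rpow_le_rpow ?_ (by norm_num)
      rw [enorm_le_iff_norm_le, Real.norm_of_nonneg (by positivity), Pi.sub_apply, two_mul]
      exact (norm_sub_le _ _).trans
        (add_le_add (norm_tilt_le hx.1 hx.2 g ξ) (norm_tilt_le h1 h2 g ξ))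
    · have := (eLpNorm_lt_top_iff_lintegral_rpow_enorm_lt_top (by norm_num) (by norm_num)).1 hb.2
      simpa using this.ne
    · refine Eventually.of_forall fun ξ => ?_
      have hc : Continuous fun x => ‖(tilt x g - tilt x₀ g) ξ‖ₑ ^ (2 : ℝ) := by
        simp only [Pi.sub_apply, tilt]
        refine ENNReal.continuous_rpow_const.comp (Continuous.enorm ?_)
        fun_prop
      have := hc.tendsto x₀
      simp only [sub_self, Pi.zero_apply, enorm_zero] at this
      rw [ENNReal.zero_rpow_of_pos (by norm_num)] at this
      exact this.mono_left nhdsWithin_le_nhds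
  have h3 := (ENNReal.continuous_rpow_const (y := (1 / 2 : ℝ))).tendsto _ |>.comp key
  simp only [lintegral_zero] at h3
  rw [ENNReal.zero_rpow_of_pos (by norm_num)] at h3
  refine h3.congr fun x => ?_
  rw [eLpNorm_eq_lintegral_rpow_enorm_toReal (by norm_num) (by norm_num)]
  simp

/-! ### The measure `ω_{a,ρ}` and its lines -/

/-- The vertical line `y ↦ x + i y`. -/
noncomputable def line (x : ℝ) : ℝ → ℂ := fun y => (x : ℂ) + (y : ℂ) * Complex.I

theorem continuous_line (x : ℝ) : Continuous (line x) := by unfold line; fun_prop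

theorem line_re (x y : ℝ) : (line x y).re = x := by simp [line]

theorem line_im (x y : ℝ) : (line x y).im = y := by simp [line]

theorem measurableEmbedding_line (x : ℝ) : MeasurableEmbedding (line x) :=
  (continuous_line x).measurableEmbedding fun y y' h => by
    simpa [line_im] using congrArg Complex.im h

theorem omega_eq_sum (a ρ : ℝ) : omega a ρ = Measure.sum fun n : ℕ =>
    ENNReal.ofReal (a ^ n / (n.factorial : ℝ)) •
      (volume : Measure ℝ).map (line (ρ * (n : ℝ) / 2)) := by
  refine Measure.ext_of_lintegral _ fun g hg => ?_
  rw [lintegral_omega a ρ g hg, lintegral_sum_measure]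
  refine tsum_congr fun n => ?_
  rw [lintegral_smul_measure, lintegral_map hg (continuous_line _).measurable, smul_eq_mul]
  rfl

theorem lintegral_omega_eq_tsum (a ρ : ℝ) (g : ℂ → ℝ≥0∞) :
    ∫⁻ z, g z ∂(omega a ρ) = ∑' n : ℕ, ENNReal.ofReal (a ^ n / (n.factorial : ℝ)) *
      ∫⁻ y, g (line (ρ * (n : ℝ) / 2) y) := by
  rw [omega_eq_sum, lintegral_sum_measure]
  refine tsum_congr fun n => ?_
  rw [lintegral_smul_measure, (measurableEmbedding_line _).lintegral_map, smul_eq_mul]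

theorem ofReal_coeff_ne_zero {a : ℝ} (ha : 0 < a) (n : ℕ) :
    ENNReal.ofReal (a ^ n / (n.factorial : ℝ)) ≠ 0 := by
  rw [Ne, ENNReal.ofReal_eq_zero, not_le]; positivity

theorem smul_map_line_le_omega (a ρ : ℝ) (n : ℕ) :
    ENNReal.ofReal (a ^ n / (n.factorial : ℝ)) •
      (volume : Measure ℝ).map (line (ρ * (n : ℝ) / 2)) ≤ omega a ρ := by
  rw [omega_eq_sum]
  exact Measure.le_sum (fun n : ℕ => ENNReal.ofReal (a ^ n / (n.factorial : ℝ)) •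
      (volume : Measure ℝ).map (line (ρ * (n : ℝ) / 2))) n

variable {a ρ : ℝ}

theorem ae_omega_iff (ha : 0 < a) {q : ℂ → Prop} :
    (∀ᵐ z ∂(omega a ρ), q z) ↔ ∀ n : ℕ, ∀ᵐ y : ℝ, q (line (ρ * (n : ℝ) / 2) y) := by
  rw [omega_eq_sum, Measure.ae_sum_iff]
  refine forall_congr' fun n => ?_
  rw [Measure.ae_ennreal_smul_measure_iff (ofReal_coeff_ne_zero ha n),
    (measurableEmbedding_line _).ae_map_iff]

theorem memLp_onLine (ha : 0 < a) {p : ℝ≥0∞} {F : ℂ → ℂ} (hF : MemLp F p (omega a ρ)) (n : ℕ) :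
    MemLp (onLine F (ρ * (n : ℝ) / 2)) p volume := by
  have h := (hF.mono_measure (smul_map_line_le_omega a ρ n)).smul_measure
    (c := (ENNReal.ofReal (a ^ n / (n.factorial : ℝ)))⁻¹)
    (ENNReal.inv_ne_top.2 (ofReal_coeff_ne_zero ha n))
  rw [smul_smul, ENNReal.inv_mul_cancel (ofReal_coeff_ne_zero ha n) ENNReal.ofReal_ne_top,
    one_smul] at h
  exact h.comp_of_map (continuous_line _).aemeasurable

theorem eLpNorm_onLine_le (a ρ : ℝ) {p : ℝ≥0∞} (hp : p ≠ ⊤) (F : ℂ → ℂ) (n : ℕ) :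
    ENNReal.ofReal (a ^ n / (n.factorial : ℝ)) ^ (1 / p).toReal *
      eLpNorm (onLine F (ρ * (n : ℝ) / 2)) p volume ≤ eLpNorm F p (omega a ρ) := by
  refine le_trans (le_of_eq ?_) (eLpNorm_mono_measure F (smul_map_line_le_omega a ρ n))
  rw [eLpNorm_smul_measure_of_ne_top hp, smul_eq_mul,
    (measurableEmbedding_line _).eLpNorm_map_measure]
  rfl

theorem hasSum_integral_omega (ha : 0 < a) {h : ℂ → ℂ} (hh : Integrable h (omega a ρ)) :
    HasSum (fun n : ℕ => ((a ^ n / (n.factorial : ℝ) : ℝ) : ℂ) *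
      ∫ y, onLine h (ρ * (n : ℝ) / 2) y) (∫ z, h z ∂(omega a ρ)) := by
  rw [omega_eq_sum] at hh ⊢
  convert! hasSum_integral_measure hh using 2 with n
  rw [integral_smul_measure, (measurableEmbedding_line _).integral_map,
    ENNReal.toReal_ofReal (by positivity), Complex.real_smul]
  rfl

/-- Restriction of functions in `L²(ω_{a,ρ})` to the `n`-th line carrying `ω_{a,ρ}`. -/
noncomputable def restrictLine (ρ : ℝ) (ha : 0 < a) (n : ℕ) :
    Lp ℂ 2 (omega a ρ) →L[ℂ] Lp ℂ 2 (volume : Measure ℝ) :=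
  LinearMap.mkContinuous
    { toFun := fun F => (memLp_onLine ha (Lp.memLp F) n).toLp _
      map_add' := fun F G => by
        rw [← MemLp.toLp_add, MemLp.toLp_eq_toLp_iff]
        exact (ae_omega_iff ha).1 (Lp.coeFn_add F G) n
      map_smul' := fun c F => by
        rw [RingHom.id_apply, ← MemLp.toLp_const_smul, MemLp.toLp_eq_toLp_iff]
        exact (ae_omega_iff ha).1 (Lp.coeFn_smul c F) n }
    ((ENNReal.ofReal (a ^ n / (n.factorial : ℝ)) ^ (1 / 2 : ℝ≥0∞).toReal).toReal)⁻¹ (fun F => by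
      have hc : 0 < (ENNReal.ofReal (a ^ n / (n.factorial : ℝ)) ^
          (1 / 2 : ℝ≥0∞).toReal).toReal := by
        refine ENNReal.toReal_pos ?_ ?_
        · exact (ENNReal.rpow_pos (pos_iff_ne_zero.2 (ofReal_coeff_ne_zero ha n))
            ENNReal.ofReal_ne_top).ne'
        · exact ENNReal.rpow_ne_top_of_nonneg (by positivity) ENNReal.ofReal_ne_top
      rw [LinearMap.coe_mk, AddHom.coe_mk, Lp.norm_toLp, le_inv_mul_iff₀ hc, ← ENNReal.toReal_mul,
        Lp.norm_def]
      exact ENNReal.toReal_mono (Lp.eLpNorm_ne_top F) (eLpNorm_onLine_le a ρ (by norm_num) F n))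

theorem restrictLine_apply (ha : 0 < a) (n : ℕ) (F : Lp ℂ 2 (omega a ρ)) :
    restrictLine ρ ha n F = (memLp_onLine ha (Lp.memLp F) n).toLp _ := rfl

/-! ### Shifting a vertical line of integration -/

/-- Integrability over a vertical strip from a bound on the lines. -/
theorem integrable_strip {h : ℂ → ℂ} (hd : DifferentiableOn ℂ h {z : ℂ | 0 < z.re}) {x₁ x₂ : ℝ}
    (h1 : 0 < x₁) {K : ℝ≥0∞} (hK : K ≠ ⊤)
    (hb : ∀ x ∈ Icc x₁ x₂, ∫⁻ y, ‖onLine h x y‖ₑ ≤ K) :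
    Integrable (fun q : ℝ × ℝ => onLine h q.1 q.2)
      ((volume.restrict (Ioc x₁ x₂)).prod volume) := by
  have hm : AEStronglyMeasurable (fun q : ℝ × ℝ => onLine h q.1 q.2)
      ((volume.restrict (Ioc x₁ x₂)).prod volume) := by
    have e : (volume.restrict (Ioc x₁ x₂)).prod (volume : Measure ℝ) =
        (volume : Measure (ℝ × ℝ)).restrict (Ioc x₁ x₂ ×ˢ univ) := by
      rw [Measure.volume_eq_prod, ← Measure.prod_restrict, Measure.restrict_univ]
    rw [e]
    refine ContinuousOn.aestronglyMeasurable ?_ (measurableSet_Ioc.prod MeasurableSet.univ)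
    refine hd.continuousOn.comp (f := fun q : ℝ × ℝ => (q.1 : ℂ) + (q.2 : ℂ) * Complex.I)
      (by fun_prop) fun q hq => ?_
    have := hq.1.1
    simp only [Set.mem_ofPred_eq]
    simp
    linarith
  refine ⟨hm, ?_⟩
  rw [HasFiniteIntegral, lintegral_prod _ hm.enorm]
  calc ∫⁻ x in Ioc x₁ x₂, ∫⁻ y, ‖onLine h x y‖ₑ ≤ ∫⁻ _x in Ioc x₁ x₂, K :=
        setLIntegral_mono measurable_const fun x hx => hb x ⟨hx.1.le, hx.2⟩
    _ < ⊤ := by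
        rw [setLIntegral_const]
        exact ENNReal.mul_lt_top hK.lt_top (by simp)

/-- The integral of a holomorphic function over a vertical line does not depend on the line when
the function is bounded in `L¹` on the lines: by Cauchy's theorem on the rectangle of height `2 T`
the difference of the integrals is the limit, as `T → ∞`, of a function of `T` which is integrable,
so this limit can only be `0`. -/
theorem integral_onLine_eq {h : ℂ → ℂ} (hd : DifferentiableOn ℂ h {z : ℂ | 0 < z.re}) {x₁ x₂ : ℝ}
    (h1 : 0 < x₁) (h12 : x₁ ≤ x₂) {K : ℝ≥0∞} (hK : K ≠ ⊤)
    (hb : ∀ x ∈ Icc x₁ x₂, ∫⁻ y, ‖onLine h x y‖ₑ ≤ K) :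
    ∫ y, onLine h x₁ y = ∫ y, onLine h x₂ y := by
  have hline : ∀ x ∈ Icc x₁ x₂, Integrable (onLine h x) := fun x hx =>
    ⟨(continuous_onLine hd (h1.trans_le hx.1)).aestronglyMeasurable,
      (hb x hx).trans_lt hK.lt_top⟩
  set J : ℝ → ℂ := fun y => ∫ x in Ioc x₁ x₂, onLine h x y with hJ
  have hJi : Integrable J := (integrable_strip hd h1 hK hb).integral_prod_right
  set D : ℝ → ℂ := fun T => (∫ y in -T..T, onLine h x₂ y) - ∫ y in -T..T, onLine h x₁ y with hD
  have hlim : Tendsto D atTop (𝓝 ((∫ y, onLine h x₂ y) - ∫ y, onLine h x₁ y)) :=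
    (intervalIntegral_tendsto_integral (hline x₂ ⟨h12, le_rfl⟩) tendsto_neg_atTop_atBot
      tendsto_id).sub
    (intervalIntegral_tendsto_integral (hline x₁ ⟨le_rfl, h12⟩) tendsto_neg_atTop_atBot tendsto_id)
  have hDJ : D = fun T => -Complex.I * (J T - J (-T)) := by
    ext T
    have := Complex.integral_boundary_rect_eq_zero_of_differentiableOn h
      ((x₁ : ℂ) + ((-T : ℝ) : ℂ) * Complex.I) ((x₂ : ℂ) + ((T : ℝ) : ℂ) * Complex.I)
      (hd.mono fun z hz => by
        have h3 := hz.1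
        simp only [Complex.add_re, Complex.ofReal_re, Complex.mul_re, Complex.I_re, mul_zero,
          Complex.ofReal_im, Complex.I_im, mul_one, sub_self, add_zero, mem_preimage,
          uIcc_of_le h12] at h3
        exact h1.trans_le h3.1)
    simp only [Complex.add_re, Complex.ofReal_re, Complex.mul_re, Complex.I_re, mul_zero,
          Complex.ofReal_im, Complex.I_im, mul_one, sub_self, add_zero, Complex.add_im,
          Complex.mul_im, zero_add, smul_eq_mul] at this
    rw [intervalIntegral.integral_of_le h12, intervalIntegral.integral_of_le h12] at this
    simp only [hD, hJ, onLine]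
    linear_combination -Complex.I * this +
      ((∫ y in -T..T, h (x₁ + y * Complex.I)) - ∫ y in -T..T, h (x₂ + y * Complex.I)) *
        (-Complex.I_mul_I)
  have hDi : Integrable D := by
    rw [hDJ]
    exact (hJi.sub hJi.comp_neg).const_mul _
  -- `D` is integrable near infinity, where it tends to the difference of the two integrals
  have h0 := IntegrableAtFilter.eq_zero_of_tendsto (hDi.integrableAtFilter atTop)
    (fun s hs => by
      obtain ⟨b, hb⟩ := mem_atTop_sets.1 hs
      exact measure_mono_top (fun y hy => hb y hy) (Real.volume_Ici (a := b))) hlim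
  exact (sub_eq_zero.1 h0).symm

/-! ### Fourier transforms along the lines of elements of `M²` -/

theorem inner_toLp_left {A : ℝ → ℂ} (hA : MemLp A 2 volume) (U : Lp ℂ 2 (volume : Measure ℝ)) :
    inner ℂ (hA.toLp A) U = ∫ ξ, (starRingEnd ℂ) (A ξ) * U ξ := by
  rw [L2.inner_def]
  refine integral_congr_ae ?_
  filter_upwards [hA.coeFn_toLp] with y h
  rw [h, RCLike.inner_apply, mul_comm]

open FourierTransform in
theorem inner_toLp_fourier {g u : ℝ → ℂ} (h1 : Integrable g) (h2 : MemLp g 2 volume)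
    (hu : MemLp u 2 volume) :
    inner ℂ (h2.toLp g) (𝓕 (hu.toLp u)) = ∫ y, (starRingEnd ℂ) (𝓕⁻ g y) * u y := by
  rw [inner_toLp_left, integral_conj_fourierInv_mul h1 h2 hu]

theorem conj_laplace (ψ : ℝ → ℂ) (z : ℂ) :
    (starRingEnd ℂ) (laplace ψ z) =
      laplace (fun ξ => (starRingEnd ℂ) (ψ ξ)) ((starRingEnd ℂ) z) := by
  rw [laplace, laplace, ← integral_conj]
  refine integral_congr_ae (Eventually.of_forall fun ξ => ?_)
  simp only [map_mul, ← Complex.exp_conj, Complex.conj_ofReal, map_ofNat]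

theorem tilt_conj (x : ℝ) (ψ : ℝ → ℂ) :
    tilt x (fun ξ => (starRingEnd ℂ) (ψ ξ)) = fun ξ => (starRingEnd ℂ) (tilt x ψ ξ) := by
  ext ξ
  simp only [tilt, map_mul, Complex.conj_ofReal]

theorem integrable_tilt_of_forall {ψ : ℝ → ℂ} (hψ : ∀ x, MemLp (tilt x ψ) 2 volume) (x : ℝ) :
    Integrable (tilt x ψ) :=
  integrable_tilt (sub_one_lt x) (lt_add_one x) (hψ _) (hψ _)

theorem MemHardyStrip.memLp_onLine {f : ℂ → ℂ} (hf : DifferentiableOn ℂ f {z : ℂ | 0 < z.re})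
    (hH : ∀ b : ℝ, 0 < b → MemHardyStrip 2 0 b f) {x : ℝ} (hx : 0 < x) :
    MemLp (onLine f x) 2 volume :=
  ⟨(continuous_onLine hf hx).aestronglyMeasurable,
    (le_iSup₂ (f := fun t (_ : t ∈ Ioo 0 (x + 1)) => eLpNorm (onLine f t) 2 volume) x
      ⟨hx, lt_add_one x⟩).trans_lt (hH (x + 1) (by linarith)).2⟩

open FourierTransform in
/-- The pairing of `exp (-2 π x ξ) ψ ξ` with the Fourier transform of `f (x + i ·)` does not depend
on `x`: it is the integral over the line `Re z = x` of a function holomorphic in the half-plane. -/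
theorem inner_tilt_neg_fourier_onLine_eq {f : ℂ → ℂ}
    (hf : DifferentiableOn ℂ f {z : ℂ | 0 < z.re})
    (hH : ∀ b : ℝ, 0 < b → MemHardyStrip 2 0 b f)
    {ψ : ℝ → ℂ} (hψ : ∀ x, MemLp (tilt x ψ) 2 volume) {x₁ x₂ : ℝ} (h1 : 0 < x₁) (h12 : x₁ ≤ x₂) :
    inner ℂ ((hψ (-x₁)).toLp _) (𝓕 ((MemHardyStrip.memLp_onLine hf hH h1).toLp _)) =
      inner ℂ ((hψ (-x₂)).toLp _)
        (𝓕 ((MemHardyStrip.memLp_onLine hf hH (h1.trans_le h12)).toLp _)) := by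
  have hψi := integrable_tilt_of_forall hψ
  rw [inner_toLp_fourier (hψi _), inner_toLp_fourier (hψi _)]
  set ψ' : ℝ → ℂ := fun ξ => (starRingEnd ℂ) (ψ ξ) with hψ'
  -- conjugation turns the inverse Fourier transform of `ψ` into a holomorphic function of `z`
  set h : ℂ → ℂ := fun z => laplace ψ' (-z) * f z with hh
  have hψ'i : ∀ x, Integrable (tilt x ψ') := fun x => by
    rw [hψ', tilt_conj]
    exact (Complex.conjLIE.integrable_comp_iff).2 (hψi x)
  have hd : DifferentiableOn ℂ h {z : ℂ | 0 < z.re} := by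
    refine DifferentiableOn.mul (fun z _ => DifferentiableAt.differentiableWithinAt ?_) hf
    exact (differentiableAt_laplace (sub_one_lt _) (lt_add_one _) (hψ'i _) (hψ'i _)).comp z
      differentiableAt_id.neg
  have hhx : ∀ x, onLine h x = fun y => (starRingEnd ℂ) (𝓕⁻ (tilt (-x) ψ) y) * onLine f x y := by
    intro x
    ext y
    rw [← onLine_laplace]
    simp only [onLine, hh, conj_laplace, hψ']
    congr 2
    simp
    ring
  rw [← hhx, ← hhx]
  refine integral_onLine_eq hd h1 h12
    (K := (eLpNorm (tilt (-x₂) ψ) 2 volume + eLpNorm (tilt (-x₁) ψ) 2 volume) *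
      ⨆ x ∈ Ioo 0 (x₂ + 1), eLpNorm (onLine f x) 2 volume) ?_ fun x hx => ?_
  · exact ENNReal.mul_ne_top (ENNReal.add_ne_top.2 ⟨(hψ _).eLpNorm_ne_top, (hψ _).eLpNorm_ne_top⟩)
      (hH (x₂ + 1) (by linarith)).2.ne
  · have hx0 : 0 < x := h1.trans_le hx.1
    rw [← eLpNorm_one_eq_lintegral_enorm, hhx]
    have e : eLpNorm (fun y => (starRingEnd ℂ) (𝓕⁻ (tilt (-x) ψ) y)) 2 volume =
        eLpNorm (𝓕⁻ (tilt (-x) ψ)) 2 volume :=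
      eLpNorm_congr_norm_ae (Eventually.of_forall fun y => RCLike.norm_conj _)
    refine (eLpNorm_smul_le_mul_eLpNorm (p := 2) (q := 2) (r := 1)
      (MemHardyStrip.memLp_onLine hf hH hx0).1
      (φ := fun y => (starRingEnd ℂ) (𝓕⁻ (tilt (-x) ψ) y)) ?_).trans ?_
    · exact Complex.continuous_conj.comp_aestronglyMeasurable
        (memLp_fourierInv (hψi _) (hψ _)).1
    · rw [e, eLpNorm_fourierInv (hψi _) (hψ _)]
      gcongr
      · exact eLpNorm_tilt_le (by linarith [hx.2]) (by linarith [hx.1]) (hψ _) (hψ _)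
      · exact le_iSup₂ (f := fun x (_ : x ∈ Ioo 0 (x₂ + 1)) => eLpNorm (onLine f x) 2 volume) x
          ⟨hx0, by linarith [hx.2]⟩

open FourierTransform in
/-- The Fourier transform of `f (x + i ·)` is `exp (2 π x ξ)` times the Fourier transform of the
boundary values, tested against `ψ`. -/
theorem inner_fourier_onLine {f : ℂ → ℂ}
    (hf : DifferentiableOn ℂ f {z : ℂ | 0 < z.re})
    (hH : ∀ b : ℝ, 0 < b → MemHardyStrip 2 0 b f) {u : ℝ → ℂ} (hu : HasBoundaryValues 2 f u)
    {ψ : ℝ → ℂ} (hψ : ∀ x, MemLp (tilt x ψ) 2 volume) {x : ℝ} (hx : 0 < x) :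
    inner ℂ ((hψ 0).toLp _) (𝓕 ((MemHardyStrip.memLp_onLine hf hH hx).toLp _)) =
      inner ℂ ((hψ x).toLp _) (𝓕 (hu.1.toLp u)) := by
  -- the pairing for `tilt x ψ` at `x` is compared with its limit along lines tending to the axis
  have hχ : ∀ y, MemLp (tilt y (tilt x ψ)) 2 volume := fun y => by
    rw [tilt_tilt]; exact hψ _
  set s : ℕ → ℝ := fun k => x * ((k : ℝ) + 1)⁻¹ with hs
  have hs0 : ∀ k, 0 < s k := fun k => by positivity
  have hsx : ∀ k, s k ≤ x := fun k =>
    mul_le_of_le_one_right hx.le (inv_le_one_of_one_le₀ (by simp))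
  have hst : Tendsto s atTop (𝓝 0) := by
    have := (tendsto_one_div_add_atTop_nhds_zero_nat (𝕜 := ℝ)).const_mul x
    simpa [hs, one_div] using this
  have hA : Tendsto (fun k => (hχ (-s k)).toLp _) atTop (𝓝 ((hχ 0).toLp _)) := by
    rw [Lp.tendsto_Lp_iff_tendsto_eLpNorm'']
    refine (tendsto_eLpNorm_tilt_sub (α := -x) (β := 0) (x₀ := 0) (by linarith) le_rfl
      (hχ _) (hχ _)).comp (tendsto_nhdsWithin_iff.2 ⟨by simpa using hst.neg, ?_⟩)
    exact Eventually.of_forall fun k => ⟨by linarith [hsx k], by linarith [hs0 k]⟩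
  have hB : Tendsto (fun k => (MemHardyStrip.memLp_onLine hf hH (hs0 k)).toLp _) atTop
      (𝓝 (hu.1.toLp u)) := by
    rw [Lp.tendsto_Lp_iff_tendsto_eLpNorm'']
    exact hu.2.comp (tendsto_nhdsWithin_iff.2 ⟨hst, Eventually.of_forall hs0⟩)
  have hB' := ((Lp.fourierTransformₗᵢ ℝ ℂ).continuous.tendsto _).comp hB
  have hlim := hA.inner (𝕜 := ℂ) hB'
  have hc : ∀ k, inner ℂ ((hχ (-s k)).toLp _)
      (𝓕 ((MemHardyStrip.memLp_onLine hf hH (hs0 k)).toLp _)) =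
      inner ℂ ((hχ (-x)).toLp _) (𝓕 ((MemHardyStrip.memLp_onLine hf hH hx).toLp _)) :=
    fun k => inner_tilt_neg_fourier_onLine_eq hf hH hχ (hs0 k) (hsx k)
  have hlim' := tendsto_nhds_unique (hlim.congr hc) tendsto_const_nhds
  have e1 : (hχ (-x)).toLp _ = (hψ 0).toLp _ := by
    rw [MemLp.toLp_eq_toLp_iff, tilt_tilt, neg_add_cancel]
  have e2 : (hχ 0).toLp _ = (hψ x).toLp _ := by
    rw [MemLp.toLp_eq_toLp_iff, tilt_tilt, zero_add]
  rw [e1, e2] at hlim'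
  exact hlim'.symm

open FourierTransform in
/-- Necessary condition on the Fourier transforms along the lines of an element of `M²`. -/
theorem MemM.inner_fourier_restrictLine (ha : 0 < a) (hρ : 0 < ρ)
    {F : Lp ℂ 2 (omega a ρ)} (hF : MemM a ρ 2 F) {ψ : ℝ → ℂ}
    (hψ : ∀ x, MemLp (tilt x ψ) 2 volume) (n : ℕ) :
    inner ℂ ((hψ 0).toLp _) (𝓕 (restrictLine ρ ha n F)) =
      inner ℂ ((hψ (ρ * (n : ℝ) / 2)).toLp _) (𝓕 (restrictLine ρ ha 0 F)) := by
  obtain ⟨-, f, hf, hH, hae, hu⟩ := hF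
  have e0 : restrictLine ρ ha 0 F = hu.1.toLp _ := by
    rw [restrictLine_apply, MemLp.toLp_eq_toLp_iff]
    simp
  rcases n.eq_zero_or_pos with rfl | hn
  · congr 1
    rw [MemLp.toLp_eq_toLp_iff]
    simp
  · have hx : 0 < ρ * (n : ℝ) / 2 := by positivity
    have en : restrictLine ρ ha n F = (MemHardyStrip.memLp_onLine hf hH hx).toLp _ := by
      rw [restrictLine_apply, MemLp.toLp_eq_toLp_iff]
      filter_upwards [(ae_omega_iff ha).1 hae n] with y hy
      exact hy (by rwa [line_re])
    rw [e0, en]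
    exact inner_fourier_onLine hf hH hu hψ hx

/-! ### The Paley–Wiener description of `M²` and its closedness -/

open FourierTransform in
theorem eLpNorm_coeFn_fourierInv (U : Lp ℂ 2 (volume : Measure ℝ)) :
    eLpNorm (⇑(𝓕⁻ U : Lp ℂ 2 (volume : Measure ℝ))) 2 volume = eLpNorm U 2 volume := by
  have h := (Lp.fourierTransformₗᵢ ℝ ℂ).symm.norm_map U
  rwa [Lp.norm_def, Lp.norm_def,
    ENNReal.toReal_eq_toReal_iff' (Lp.eLpNorm_ne_top _) (Lp.eLpNorm_ne_top _)] at h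

theorem memLp_tilt_of_lines (hρ : 0 < ρ) {g : ℝ → ℂ}
    (hg : ∀ n : ℕ, MemLp (tilt (ρ * (n : ℝ) / 2) g) 2 volume) {x : ℝ} (hx : 0 ≤ x) :
    MemLp (tilt x g) 2 volume := by
  obtain ⟨n, hn⟩ := exists_nat_ge (2 * x / ρ)
  rw [div_le_iff₀ hρ] at hn
  have h0 := hg 0
  simp only [Nat.cast_zero, mul_zero, zero_div] at h0
  exact memLp_tilt hx (by linarith) h0 (hg n)

open FourierTransform in
/-- A function in `L²(ω_{a,ρ})` belongs to `M²` if its Fourier transforms along the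
lines are `exp (2 π x ξ) g ξ`: it is then the Laplace transform of `g`. -/
theorem memM_of_tilt (ha : 0 < a) (hρ : 0 < ρ) {F : ℂ → ℂ}
    (hF : MemLp F 2 (omega a ρ)) {g : ℝ → ℂ}
    (hg : ∀ n : ℕ, MemLp (tilt (ρ * (n : ℝ) / 2) g) 2 volume)
    (hFg : ∀ n : ℕ, onLine F (ρ * (n : ℝ) / 2) =ᵐ[volume]
      ⇑(𝓕⁻ ((hg n).toLp _) : Lp ℂ 2 (volume : Measure ℝ))) :
    MemM a ρ 2 F := by
  have hg' : ∀ x, 0 ≤ x → MemLp (tilt x g) 2 volume := fun x hx => memLp_tilt_of_lines hρ hg hx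
  have hgi : ∀ x, 0 < x → Integrable (tilt x g) := fun x hx =>
    integrable_tilt hx (lt_add_one x) (hg' 0 le_rfl) (hg' _ (by linarith))
  have hd : DifferentiableOn ℂ (laplace g) {z : ℂ | 0 < z.re} := fun z hz =>
    (differentiableAt_laplace (half_lt_self hz) (lt_add_one _)
      (hgi _ (half_pos hz)) (hgi _ (add_pos hz one_pos))).differentiableWithinAt
  have h0 : onLine F 0 =ᵐ[volume]
      ⇑(𝓕⁻ ((hg' 0 le_rfl).toLp _) : Lp ℂ 2 (volume : Measure ℝ)) := by
    have h := hFg 0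
    have e : (hg 0).toLp _ = (hg' 0 le_rfl).toLp _ := by
      rw [MemLp.toLp_eq_toLp_iff]; simp
    rw [e] at h
    simpa using h
  have hline : ∀ x (hx : 0 < x), onLine (laplace g) x =ᵐ[volume]
      ⇑(𝓕⁻ ((hg' x hx.le).toLp _) : Lp ℂ 2 (volume : Measure ℝ)) := fun x hx => by
    rw [onLine_laplace]
    exact (coeFn_fourierInv_toLp (hgi x hx) _).symm
  refine ⟨hF, laplace g, hd, fun b hb => ⟨hd.mono fun z hz => hz.1, ?_⟩, ?_, ?_, ?_⟩
  · refine lt_of_le_of_lt (iSup₂_le fun x hx => ?_) (ENNReal.add_lt_top.2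
      ⟨(hg' 0 le_rfl).eLpNorm_lt_top, (hg' b hb.le).eLpNorm_lt_top⟩)
    rw [onLine_laplace, eLpNorm_fourierInv (hgi x hx.1) (hg' x hx.1.le)]
    exact eLpNorm_tilt_le hx.1.le hx.2.le (hg' 0 le_rfl) (hg' b hb.le)
  · rw [ae_omega_iff ha]
    intro n
    rcases n.eq_zero_or_pos with rfl | hn
    · exact Eventually.of_forall fun y hy => by simp [line_re] at hy
    · filter_upwards [hFg n, hline (ρ * (n : ℝ) / 2) (by positivity)] with y h1 h2 _
      exact h1.trans h2.symm
  · exact (memLp_congr_ae h0).2 (Lp.memLp _)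
  · have ht := (tendsto_eLpNorm_tilt_sub le_rfl zero_le_one (hg' 0 le_rfl)
      (hg' 1 zero_le_one)).mono_left (nhdsWithin_le_of_mem (mem_of_superset
        (Ioo_mem_nhdsGT one_pos) Ioo_subset_Icc_self) : 𝓝[>] (0 : ℝ) ≤ 𝓝[Icc 0 1] 0)
    refine ht.congr' ?_
    filter_upwards [self_mem_nhdsWithin] with x hx
    have hx : 0 < x := hx
    have e : onLine (laplace g) x - onLine F 0 =ᵐ[volume]
        ⇑(𝓕⁻ (((hg' x hx.le).sub (hg' 0 le_rfl)).toLp _) : Lp ℂ 2 (volume : Measure ℝ)) := by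
      have e1 : (𝓕⁻ (((hg' x hx.le).sub (hg' 0 le_rfl)).toLp _) : Lp ℂ 2 (volume : Measure ℝ)) =
          𝓕⁻ ((hg' x hx.le).toLp _) - 𝓕⁻ ((hg' 0 le_rfl).toLp _) := by
        rw [MemLp.toLp_sub]
        exact (Lp.fourierTransformₗᵢ ℝ ℂ).symm.map_sub _ _
      rw [e1]
      filter_upwards [hline x hx, h0, Lp.coeFn_sub (𝓕⁻ ((hg' x hx.le).toLp _))
        (𝓕⁻ ((hg' 0 le_rfl).toLp _))] with y h2 h3 h4
      rw [h4, Pi.sub_apply, Pi.sub_apply, h2, h3]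
    rw [eLpNorm_congr_ae e, eLpNorm_coeFn_fourierInv]
    exact eLpNorm_congr_ae (MemLp.coeFn_toLp _).symm

theorem memLp_tilt_of_hasCompactSupport {ψ : ℝ → ℂ} (hc : Continuous ψ)
    (hs : HasCompactSupport ψ) (x : ℝ) : MemLp (tilt x ψ) 2 volume :=
  Continuous.memLp_of_hasCompactSupport (by unfold tilt; fun_prop) hs.mul_left

open FourierTransform in
/-- Converse of `MemM.inner_fourier_restrictLine`. -/
theorem memM_of_inner_fourier (ha : 0 < a) (hρ : 0 < ρ) {F : Lp ℂ 2 (omega a ρ)}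
    (h : ∀ (n : ℕ) (ψ : ℝ → ℂ) (hψ : ∀ x, MemLp (tilt x ψ) 2 volume),
      inner ℂ ((hψ 0).toLp _) (𝓕 (restrictLine ρ ha n F)) =
      inner ℂ ((hψ (ρ * (n : ℝ) / 2)).toLp _) (𝓕 (restrictLine ρ ha 0 F))) :
    MemM a ρ 2 F := by
  set g : ℝ → ℂ := ⇑(𝓕 (restrictLine ρ ha 0 F) : Lp ℂ 2 (volume : Measure ℝ)) with hg
  have hgm : MemLp g 2 volume := Lp.memLp _
  have key : ∀ n : ℕ,
      ⇑(𝓕 (restrictLine ρ ha n F) : Lp ℂ 2 (volume : Measure ℝ)) =ᵐ[volume]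
        tilt (ρ * (n : ℝ) / 2) g := by
    intro n
    refine ae_eq_of_integral_contDiff_smul_eq
      ((Lp.memLp _).locallyIntegrable (by norm_num)) ?_ fun φ hφ hφc => ?_
    · have := (hgm.locallyIntegrable (by norm_num)).locallyIntegrableOn (s := univ)
      rw [← locallyIntegrableOn_univ]
      exact this.continuousOn_mul (g := fun ξ : ℝ => (Real.exp (2 * Real.pi *
        (ρ * (n : ℝ) / 2) * ξ) : ℂ)) (by fun_prop) isOpen_univ.isLocallyClosed
    · have hψ := memLp_tilt_of_hasCompactSupport (ψ := fun ξ => (φ ξ : ℂ))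
        (Complex.continuous_ofReal.comp hφ.continuous)
        (hφc.comp_left (g := fun x : ℝ => (x : ℂ)) rfl)
      have := h n _ hψ
      rw [inner_toLp_left, inner_toLp_left] at this
      simpa only [tilt, mul_zero, zero_mul, Real.exp_zero, Complex.ofReal_one, one_mul, map_mul,
        Complex.conj_ofReal, Complex.real_smul, mul_left_comm, mul_assoc] using this
  have hgn : ∀ n : ℕ, MemLp (tilt (ρ * (n : ℝ) / 2) g) 2 volume := fun n =>
    (memLp_congr_ae (key n)).1 (Lp.memLp _)
  -- `g` is the Fourier transform on the axis, so `𝓕⁻` gives back `F` on every line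
  refine memM_of_tilt ha hρ (Lp.memLp F) hgn fun n => ?_
  have e : (hgn n).toLp _ = 𝓕 (restrictLine ρ ha n F) := by
    refine Lp.ext ?_
    exact (MemLp.coeFn_toLp _).trans (key n).symm
  rw [e, fourierInv_fourier_eq, restrictLine_apply]
  exact (MemLp.coeFn_toLp _).symm

open FourierTransform in
/-- `M²` is closed: it is cut out by the equations of `MemM.inner_fourier_restrictLine`. -/
theorem isClosed_M (ha : 0 < a) (hρ : 0 < ρ) :
    IsClosed (M a ρ 2 : Set (Lp ℂ 2 (omega a ρ))) := by
  have e : (M a ρ 2 : Set (Lp ℂ 2 (omega a ρ))) =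
      ⋂ (n : ℕ) (ψ : ℝ → ℂ) (hψ : ∀ x, MemLp (tilt x ψ) 2 volume),
        {F | inner ℂ ((hψ 0).toLp _) (𝓕 (restrictLine ρ ha n F)) =
          inner ℂ ((hψ (ρ * (n : ℝ) / 2)).toLp _) (𝓕 (restrictLine ρ ha 0 F))} := by
    ext F
    simp only [mem_iInter]
    exact ⟨fun hF n ψ hψ => MemM.inner_fourier_restrictLine ha hρ hF hψ n,
      fun h => memM_of_inner_fourier ha hρ h⟩
  rw [e]
  have hc : ∀ n, Continuous fun F => 𝓕 (restrictLine ρ ha n F) := fun n =>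
    (Lp.fourierTransformₗᵢ ℝ ℂ).continuous.comp (restrictLine ρ ha n).continuous
  exact isClosed_iInter fun n => isClosed_iInter fun ψ => isClosed_iInter fun hψ =>
    isClosed_eq (continuous_const.inner (hc n)) (continuous_const.inner (hc 0))

theorem hasOrthogonalProjection_M (ha : 0 < a) (hρ : 0 < ρ) :
    (M a ρ 2).HasOrthogonalProjection := by
  have : CompleteSpace (M a ρ 2) := (isClosed_M ha hρ).completeSpace_coe
  infer_instance

/-! ### The projection as a family of Fourier multipliers -/

theorem hasSum_inner_omega (ha : 0 < a) (F H : Lp ℂ 2 (omega a ρ)) :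
    HasSum (fun n : ℕ => ((a ^ n / (n.factorial : ℝ) : ℝ) : ℂ) *
      inner ℂ (restrictLine ρ ha n F) (restrictLine ρ ha n H)) (inner ℂ F H) := by
  rw [L2.inner_def]
  refine (hasSum_integral_omega ha (L2.integrable_inner F H)).congr_fun fun n => ?_
  rw [L2.inner_def]
  congr 1
  refine integral_congr_ae ?_
  rw [restrictLine_apply, restrictLine_apply]
  filter_upwards [(memLp_onLine ha (Lp.memLp F) n).coeFn_toLp,
    (memLp_onLine ha (Lp.memLp H) n).coeFn_toLp] with y h1 h2
  rw [h1, h2]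
  rfl

open FourierTransform in
theorem inner_fourierInv_left (U V : Lp ℂ 2 (volume : Measure ℝ)) :
    inner ℂ (𝓕⁻ U) V = inner ℂ U (𝓕 V) := by
  have h := (Lp.fourierTransformₗᵢ ℝ ℂ).inner_map_map ((Lp.fourierTransformₗᵢ ℝ ℂ).symm U) V
  rw [LinearIsometryEquiv.apply_symm_apply] at h
  exact h.symm

/-- The Fourier transform on the imaginary axis of the projection on `M²` of the function which is
the inverse Fourier transform of `ψ` on the `n`-th line and vanishes on the other lines. -/
noncomputable def projSymbol (a ρ : ℝ) (n : ℕ) (ψ : ℝ → ℂ) : ℝ → ℂ := fun ξ =>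
  ((a ^ n / (n.factorial : ℝ) * Real.exp (-(a * Real.exp (2 * Real.pi * ρ * ξ))) : ℝ) : ℂ) *
    tilt (ρ * (n : ℝ) / 2) ψ ξ

theorem continuous_projSymbol (a ρ : ℝ) (n : ℕ) {ψ : ℝ → ℂ} (hc : Continuous ψ) :
    Continuous (projSymbol a ρ n ψ) := by
  unfold projSymbol tilt; fun_prop

theorem hasCompactSupport_projSymbol (a ρ : ℝ) (n : ℕ) {ψ : ℝ → ℂ} (hs : HasCompactSupport ψ) :
    HasCompactSupport (projSymbol a ρ n ψ) :=
  hs.mul_left.mul_left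

theorem hasSum_coeff_mul_exp (a ρ ξ : ℝ) :
    HasSum (fun m : ℕ => a ^ m / (m.factorial : ℝ) * Real.exp (2 * Real.pi * (ρ * m) * ξ))
      (Real.exp (a * Real.exp (2 * Real.pi * ρ * ξ))) := by
  have h := NormedSpace.expSeries_div_hasSum_exp (a * Real.exp (2 * Real.pi * ρ * ξ))
  rw [← Real.exp_eq_exp_ℝ] at h
  refine h.congr_fun fun m => ?_
  rw [mul_pow, ← Real.exp_nat_mul, div_mul_eq_mul_div]
  congr 3; ring

open FourierTransform in
/-- The Laplace transform of a continuous function with compact support is in `L²(ω_{a,ρ})`. -/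
theorem memLp_laplace (ha : 0 < a) {g : ℝ → ℂ} (hc : Continuous g) (hs : HasCompactSupport g) :
    MemLp (laplace g) 2 (omega a ρ) := by
  have hg := memLp_tilt_of_hasCompactSupport hc hs
  have hgi := integrable_tilt_of_forall hg
  have hcont : Continuous (laplace g) := Differentiable.continuous fun z =>
    differentiableAt_laplace (sub_one_lt _) (lt_add_one _) (hgi _) (hgi _)
  refine ⟨hcont.aestronglyMeasurable, ?_⟩
  rw [eLpNorm_lt_top_iff_lintegral_rpow_enorm_lt_top (by norm_num) (by norm_num),
    lintegral_omega_eq_tsum]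
  have e1 : ∀ m : ℕ, ∫⁻ y, ‖laplace g (line (ρ * (m : ℝ) / 2) y)‖ₑ ^ (2 : ℝ≥0∞).toReal =
      ∫⁻ ξ, ‖tilt (ρ * (m : ℝ) / 2) g ξ‖ₑ ^ (2 : ℝ≥0∞).toReal := fun m => by
    have h := eLpNorm_fourierInv (hgi (ρ * (m : ℝ) / 2)) (hg _)
    rw [← onLine_laplace, eLpNorm_eq_lintegral_rpow_enorm_toReal (by norm_num) (by norm_num),
      eLpNorm_eq_lintegral_rpow_enorm_toReal (by norm_num) (by norm_num)] at h
    exact ENNReal.rpow_left_injective (by norm_num) h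
  simp_rw [e1]
  have e2 : ∀ m : ℕ, ENNReal.ofReal (a ^ m / (m.factorial : ℝ)) *
      ∫⁻ ξ, ‖tilt (ρ * (m : ℝ) / 2) g ξ‖ₑ ^ (2 : ℝ≥0∞).toReal =
      ∫⁻ ξ, ENNReal.ofReal (a ^ m / (m.factorial : ℝ) *
        Real.exp (2 * Real.pi * (ρ * m) * ξ) * ‖g ξ‖ ^ 2) := fun m => by
    rw [← lintegral_const_mul' _ _ ENNReal.ofReal_ne_top]
    refine lintegral_congr fun ξ => ?_
    have e3 : ‖tilt (ρ * (m : ℝ) / 2) g ξ‖ ^ 2 =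
        Real.exp (2 * Real.pi * (ρ * m) * ξ) * ‖g ξ‖ ^ 2 := by
      rw [norm_tilt, mul_pow, ← Real.exp_nat_mul]
      congr 2; push_cast; ring
    rw [mul_assoc, ← e3, ENNReal.ofReal_mul (by positivity), ENNReal.toReal_ofNat,
      ← ofReal_norm, ENNReal.ofReal_rpow_of_nonneg (norm_nonneg _) (by norm_num)]
    norm_num
  simp_rw [e2]
  rw [← lintegral_tsum fun m => (Continuous.measurable (by fun_prop)).ennreal_ofReal.aemeasurable]
  have e4 : ∀ ξ, ∑' m : ℕ, ENNReal.ofReal (a ^ m / (m.factorial : ℝ) *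
        Real.exp (2 * Real.pi * (ρ * m) * ξ) * ‖g ξ‖ ^ 2) =
      ENNReal.ofReal (Real.exp (a * Real.exp (2 * Real.pi * ρ * ξ)) * ‖g ξ‖ ^ 2) := fun ξ => by
    have h := (hasSum_coeff_mul_exp a ρ ξ).mul_right (‖g ξ‖ ^ 2)
    rw [← h.tsum_eq, ENNReal.ofReal_tsum_of_nonneg (fun m => by positivity) h.summable]
  simp_rw [e4]
  refine Integrable.lintegral_lt_top (Continuous.integrable_of_hasCompactSupport (by fun_prop) ?_)
  refine HasCompactSupport.mul_left ?_
  exact hs.comp_left (g := fun z : ℂ => ‖z‖ ^ 2) (by simp)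

open FourierTransform in
/-- Pairing with an element of `M²` recovers `ψ` from `projSymbol a ρ n ψ`: all the terms of the
pairing are transported to the imaginary axis, where the weights add up to
`exp (a exp (2 π ρ ξ))`, and the result is transported to the `n`-th line. -/
theorem inner_laplace_eq (ha : 0 < a) (hρ : 0 < ρ) (n : ℕ) {ψ : ℝ → ℂ} (hc : Continuous ψ)
    (hs : HasCompactSupport ψ) {G H : Lp ℂ 2 (omega a ρ)}
    (hG : ∀ m, restrictLine ρ ha m G = 𝓕⁻ ((memLp_tilt_of_hasCompactSupport
      (continuous_projSymbol a ρ n hc) (hasCompactSupport_projSymbol a ρ n hs) _).toLp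
        (tilt (ρ * (m : ℝ) / 2) (projSymbol a ρ n ψ))))
    (hH : MemM a ρ 2 H) :
    inner ℂ G H = ((a ^ n / (n.factorial : ℝ) : ℝ) : ℂ) *
      inner ℂ ((memLp_tilt_of_hasCompactSupport hc hs 0).toLp _)
        (𝓕 (restrictLine ρ ha n H)) := by
  set g := projSymbol a ρ n ψ with hg
  have hgc := continuous_projSymbol a ρ n hc
  have hgs := hasCompactSupport_projSymbol a ρ n hs
  have hgt := memLp_tilt_of_hasCompactSupport hgc hgs
  set U : ℝ → ℂ := ⇑(𝓕 (restrictLine ρ ha 0 H) : Lp ℂ 2 (volume : Measure ℝ)) with hU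
  have hUm : MemLp U 2 volume := Lp.memLp _
  have h1 : HasSum (fun m : ℕ => ∫ ξ, ((a ^ m / (m.factorial : ℝ) : ℝ) : ℂ) *
      ((starRingEnd ℂ) (tilt (ρ * m) g ξ) * U ξ)) (inner ℂ G H) := by
    refine (hasSum_inner_omega ha G H).congr_fun fun m => ?_
    have hχ : ∀ y, MemLp (tilt y (tilt (ρ * (m : ℝ) / 2) g)) 2 volume := fun y => by
      rw [tilt_tilt]; exact hgt _
    have h2 := MemM.inner_fourier_restrictLine ha hρ hH hχ m
    have e0 : (hχ 0).toLp _ = (hgt (ρ * (m : ℝ) / 2)).toLp _ := by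
      rw [MemLp.toLp_eq_toLp_iff, tilt_zero]
    rw [hG, inner_fourierInv_left, integral_const_mul, ← e0, h2, inner_toLp_left]
    simp_rw [tilt_tilt, add_halves]
    rfl
  -- the factor `exp (-a exp (2 π ρ ξ))` of the symbol is the inverse of the total weight at `ξ`
  have hcancel : ∀ ξ, ((Real.exp (a * Real.exp (2 * Real.pi * ρ * ξ)) : ℝ) : ℂ) * g ξ =
      ((a ^ n / (n.factorial : ℝ) : ℝ) : ℂ) * tilt (ρ * (n : ℝ) / 2) ψ ξ := fun ξ => by
    rw [hg, projSymbol, ← mul_assoc, ← Complex.ofReal_mul, mul_left_comm, ← Real.exp_add,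
      add_neg_cancel, Real.exp_zero, mul_one]
  have hsum : ∀ ξ, HasSum (fun m : ℕ => ((a ^ m / (m.factorial : ℝ) : ℝ) : ℂ) *
      ((starRingEnd ℂ) (tilt (ρ * m) g ξ) * U ξ))
      (((a ^ n / (n.factorial : ℝ) : ℝ) : ℂ) *
        ((starRingEnd ℂ) (tilt (ρ * (n : ℝ) / 2) ψ ξ) * U ξ)) := fun ξ => by
    have h := (Complex.hasSum_ofReal.2 (hasSum_coeff_mul_exp a ρ ξ)).mul_right
      ((starRingEnd ℂ) (g ξ) * U ξ)
    have h3 := congrArg (starRingEnd ℂ) (hcancel ξ)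
    simp only [map_mul, Complex.conj_ofReal] at h3
    rw [← mul_assoc, h3, mul_assoc] at h
    refine h.congr_fun fun m => ?_
    simp only [tilt, map_mul, Complex.conj_ofReal, Complex.ofReal_mul, mul_assoc]
  have h2 := hasSum_integral_of_dominated_convergence
    (μ := (volume : Measure ℝ))
    (F := fun (m : ℕ) ξ => ((a ^ m / (m.factorial : ℝ) : ℝ) : ℂ) *
      ((starRingEnd ℂ) (tilt (ρ * m) g ξ) * U ξ))
    (fun (m : ℕ) ξ => a ^ m / (m.factorial : ℝ) * Real.exp (2 * Real.pi * (ρ * m) * ξ) *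
      (‖g ξ‖ * ‖U ξ‖)) (fun m => ?_) (fun m => Eventually.of_forall fun ξ => ?_)
    (Eventually.of_forall fun ξ => ((hasSum_coeff_mul_exp a ρ ξ).mul_right _).summable) ?_
    (Eventually.of_forall hsum)
  · have h3 := h1.unique h2
    rw [h3, integral_const_mul]
    congr 1
    rw [MemM.inner_fourier_restrictLine ha hρ hH (memLp_tilt_of_hasCompactSupport hc hs) n,
      inner_toLp_left]
  · exact ((Complex.continuous_conj.comp_aestronglyMeasurable (hgt _).1).mul hUm.1).const_mul _
  · rw [norm_mul, norm_mul, RCLike.norm_conj, norm_tilt, Complex.norm_real,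
      Real.norm_of_nonneg (by positivity)]
    exact le_of_eq (by ring)
  · have h3 : ∀ ξ, ∑' m : ℕ, a ^ m / (m.factorial : ℝ) * Real.exp (2 * Real.pi * (ρ * m) * ξ) *
        (‖g ξ‖ * ‖U ξ‖) = ‖((a ^ n / (n.factorial : ℝ) : ℝ) : ℂ) *
          tilt (ρ * (n : ℝ) / 2) ψ ξ‖ * ‖U ξ‖ := fun ξ => by
      rw [((hasSum_coeff_mul_exp a ρ ξ).mul_right _).tsum_eq, ← hcancel, norm_mul,
        Complex.norm_real, Real.norm_of_nonneg (Real.exp_pos _).le, ← mul_assoc (Real.exp _) ‖g ξ‖]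
    simp_rw [h3]
    exact ((memLp_tilt_of_hasCompactSupport hc hs _).const_mul _).norm.integrable_mul hUm.norm

open FourierTransform in
/-- The projection on `M²` of the function which is the inverse Fourier transform of `ψ` on the
`n`-th line and vanishes on the other lines: along each line it is a Fourier multiplier. -/
theorem onLine_starProjection (ha : 0 < a) (hρ : 0 < ρ) [(M a ρ 2).HasOrthogonalProjection]
    (n : ℕ) {ψ : ℝ → ℂ} (hc : Continuous ψ) (hs : HasCompactSupport ψ) {f : Lp ℂ 2 (omega a ρ)}
    (hf : ∀ m, restrictLine ρ ha m f =
      if m = n then 𝓕⁻ ((memLp_tilt_of_hasCompactSupport hc hs 0).toLp _) else 0) (m : ℕ) :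
    onLine ((M a ρ 2).starProjection f) (ρ * (m : ℝ) / 2) =ᵐ[volume]
      𝓕⁻ (tilt (ρ * (m : ℝ) / 2) (projSymbol a ρ n ψ)) := by
  have hgc := continuous_projSymbol a ρ n hc
  have hgs := hasCompactSupport_projSymbol a ρ n hs
  have hgt := memLp_tilt_of_hasCompactSupport hgc hgs
  have hgi := integrable_tilt_of_forall hgt
  have hGm : MemLp (laplace (projSymbol a ρ n ψ)) 2 (omega a ρ) := memLp_laplace ha hgc hgs
  set G : Lp ℂ 2 (omega a ρ) := hGm.toLp _ with hG
  have hline : ∀ k : ℕ, onLine G (ρ * (k : ℝ) / 2) =ᵐ[volume]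
      𝓕⁻ (tilt (ρ * (k : ℝ) / 2) (projSymbol a ρ n ψ)) := fun k => by
    rw [← onLine_laplace]
    exact (ae_omega_iff ha).1 hGm.coeFn_toLp k
  have hline' : ∀ k : ℕ, onLine G (ρ * (k : ℝ) / 2) =ᵐ[volume]
      ⇑(𝓕⁻ ((hgt (ρ * (k : ℝ) / 2)).toLp _) : Lp ℂ 2 (volume : Measure ℝ)) := fun k =>
    (hline k).trans (coeFn_fourierInv_toLp (hgi _) (hgt _)).symm
  have hGM : MemM a ρ 2 G := memM_of_tilt ha hρ (Lp.memLp G) (fun k => hgt _) hline'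
  have hGr : ∀ k, restrictLine ρ ha k G = 𝓕⁻ ((hgt (ρ * (k : ℝ) / 2)).toLp _) := fun k => by
    refine Lp.ext ?_
    rw [restrictLine_apply]
    exact (MemLp.coeFn_toLp _).trans (hline' k)
  have hproj : (M a ρ 2).starProjection f = G := by
    refine Submodule.eq_starProjection_of_mem_of_inner_eq_zero hGM fun H hH => ?_
    have h1 : inner ℂ f H = ((a ^ n / (n.factorial : ℝ) : ℝ) : ℂ) *
        inner ℂ ((memLp_tilt_of_hasCompactSupport hc hs 0).toLp _)
          (𝓕 (restrictLine ρ ha n H)) := by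
      refine (hasSum_inner_omega ha f H).unique ?_
      rw [← inner_fourierInv_left]
      have h2 := hasSum_single (f := fun m : ℕ => ((a ^ m / (m.factorial : ℝ) : ℝ) : ℂ) *
        inner ℂ (restrictLine ρ ha m f) (restrictLine ρ ha m H)) n fun m hm => by
          simp only [hf m, if_neg hm, inner_zero_left, mul_zero]
      simpa only [hf n, if_true] using h2
    rw [inner_sub_left, h1, inner_laplace_eq ha hρ n hc hs hGr hH, sub_self]
  rw [hproj]
  exact hline m

/-! ### Functions on one line and rescaling in frequency -/

/-- The function equal to `φ` on the line `Re z = x` and to zero elsewhere. -/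
noncomputable def onLineOnly (x : ℝ) (φ : ℝ → ℂ) : ℂ → ℂ :=
  fun z => if z.re = x then φ z.im else 0

theorem onLine_onLineOnly (x x' : ℝ) (φ : ℝ → ℂ) :
    onLine (onLineOnly x φ) x' = if x' = x then φ else 0 := by
  ext y
  have : onLine (onLineOnly x φ) x' y = onLineOnly x φ (line x' y) := rfl
  rw [this, onLineOnly, line_re, line_im]
  split_ifs <;> rfl

theorem measurable_onLineOnly (x : ℝ) {φ : ℝ → ℂ} (hφ : Measurable φ) :
    Measurable (onLineOnly x φ) :=
  Measurable.ite (measurableSet_eq_fun Complex.measurable_re measurable_const)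
    (hφ.comp Complex.measurable_im) measurable_const

theorem lines_injective (hρ : 0 < ρ) (m n : ℕ) : ρ * (m : ℝ) / 2 = ρ * (n : ℝ) / 2 ↔ m = n := by
  constructor
  · intro h
    have : ρ * (m : ℝ) = ρ * n := by linarith
    exact_mod_cast mul_left_cancel₀ hρ.ne' this
  · rintro rfl; rfl

theorem eLpNorm_onLineOnly (hρ : 0 < ρ) {p : ℝ≥0∞} (hp0 : p ≠ 0) (hp : p ≠ ⊤) (n : ℕ)
    (φ : ℝ → ℂ) :
    eLpNorm (onLineOnly (ρ * (n : ℝ) / 2) φ) p (omega a ρ) =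
      ENNReal.ofReal (a ^ n / (n.factorial : ℝ)) ^ (1 / p).toReal * eLpNorm φ p volume := by
  have hp' : 0 < p.toReal := ENNReal.toReal_pos hp0 hp
  rw [eLpNorm_eq_lintegral_rpow_enorm_toReal hp0 hp, eLpNorm_eq_lintegral_rpow_enorm_toReal hp0 hp,
    lintegral_omega_eq_tsum, tsum_eq_single n, ENNReal.mul_rpow_of_nonneg _ _ (by positivity)]
  · rw [ENNReal.toReal_div, ENNReal.toReal_one]
    congr 3
    have h := onLine_onLineOnly (ρ * (n : ℝ) / 2) (ρ * (n : ℝ) / 2) φ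
    rw [if_pos rfl] at h
    ext y
    rw [← congrFun h y]
    rfl
  · intro m hm
    have h := onLine_onLineOnly (ρ * (n : ℝ) / 2) (ρ * (m : ℝ) / 2) φ
    rw [if_neg (by rwa [lines_injective hρ])] at h
    have e : ∀ y, onLineOnly (ρ * (n : ℝ) / 2) φ (line (ρ * (m : ℝ) / 2) y) = 0 := congrFun h
    simp_rw [e, enorm_zero, ENNReal.zero_rpow_of_pos hp', lintegral_zero, mul_zero]

theorem memLp_onLineOnly (hρ : 0 < ρ) {p : ℝ≥0∞} (hp0 : p ≠ 0) (hp : p ≠ ⊤) (n : ℕ)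
    {φ : ℝ → ℂ} (hm : Measurable φ) (hφ : MemLp φ p volume) :
    MemLp (onLineOnly (ρ * (n : ℝ) / 2) φ) p (omega a ρ) := by
  refine ⟨(measurable_onLineOnly _ hm).aestronglyMeasurable, ?_⟩
  rw [eLpNorm_onLineOnly hρ hp0 hp]
  exact ENNReal.mul_lt_top
    (ENNReal.rpow_lt_top_of_nonneg ENNReal.toReal_nonneg ENNReal.ofReal_ne_top) hφ.2

open FourierTransform in
theorem fourierInv_rescale (h : ℝ → ℂ) (ξ₀ : ℝ) {r : ℝ} (hr : 0 < r) :
    𝓕⁻ (fun ξ => h (r * (ξ - ξ₀))) = fun y => ((r⁻¹ : ℝ) : ℂ) *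
      (Complex.exp (((2 * Real.pi * (ξ₀ * y) : ℝ) : ℂ) * Complex.I) * 𝓕⁻ h (r⁻¹ * y)) := by
  ext y
  rw [Real.fourierInv_eq', Real.fourierInv_eq', ← integral_const_mul]
  have h1 := integral_sub_right_eq_self (μ := (volume : Measure ℝ)) (fun ξ =>
    Complex.exp (((2 * Real.pi * inner ℝ (ξ + ξ₀) y : ℝ) : ℂ) * Complex.I) • h (r * ξ)) ξ₀
  have h2 := Measure.integral_comp_mul_left (fun s => Complex.exp (((2 * Real.pi *
    inner ℝ (r⁻¹ * s + ξ₀) y : ℝ) : ℂ) * Complex.I) • h s) r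
  simp only [sub_add_cancel] at h1
  rw [h1]
  rw [abs_of_pos (inv_pos.2 hr)] at h2
  simp only [inv_mul_cancel_left₀ hr.ne'] at h2
  rw [h2, Complex.real_smul]
  congr 1
  refine integral_congr_ae (Eventually.of_forall fun s => ?_)
  simp only [smul_eq_mul]
  rw [← mul_assoc, ← Complex.exp_add]
  congr 2
  simp
  ring

open FourierTransform in
/-- The `L^p` norms of the inverse Fourier transforms of all the functions concentrated near `ξ₀` at
scale `r⁻¹` are multiplied by the same factor when rescaling. -/
theorem exists_eLpNorm_fourierInv_rescale {p : ℝ≥0∞} (hp : p ≠ ⊤) (ξ₀ : ℝ) {r : ℝ}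
    (hr : 0 < r) : ∃ K : ℝ≥0∞, K ≠ 0 ∧ K ≠ ⊤ ∧ ∀ h : ℝ → ℂ,
      eLpNorm (𝓕⁻ (fun ξ => h (r * (ξ - ξ₀)))) p volume = K * eLpNorm (𝓕⁻ h) p volume := by
  have hr' : 0 < r⁻¹ := inv_pos.2 hr
  refine ⟨‖r⁻¹‖ₑ * ENNReal.ofReal |r⁻¹⁻¹| ^ (1 / p).toReal, ?_, ?_, fun h => ?_⟩
  · refine mul_ne_zero (by simpa using hr.ne') (ENNReal.rpow_pos ?_ ENNReal.ofReal_ne_top).ne'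
    simpa using hr.ne'
  · exact ENNReal.mul_ne_top enorm_ne_top
      (ENNReal.rpow_ne_top_of_nonneg ENNReal.toReal_nonneg ENNReal.ofReal_ne_top)
  · have e : eLpNorm (𝓕⁻ (fun ξ => h (r * (ξ - ξ₀)))) p volume =
        eLpNorm (r⁻¹ • (𝓕⁻ h ∘ fun y => r⁻¹ * y)) p volume := by
      rw [fourierInv_rescale h ξ₀ hr]
      refine eLpNorm_congr_norm_ae (Eventually.of_forall fun y => ?_)
      rw [norm_mul, norm_mul, Complex.norm_exp_ofReal_mul_I, one_mul, Pi.smul_apply, norm_smul,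
        Complex.norm_real, Function.comp_apply]
    have hemb : MeasurableEmbedding fun y : ℝ => r⁻¹ * y :=
      (Homeomorph.mulLeft₀ r⁻¹ hr'.ne').measurableEmbedding
    rw [e, eLpNorm_const_smul, ← hemb.eLpNorm_map_measure, Real.map_volume_mul_left hr'.ne',
      eLpNorm_smul_measure_of_ne_top hp, smul_eq_mul, mul_assoc]

open FourierTransform in
theorem tendsto_fourierInv_concentrate {u : ℝ → ℝ} (hu : Continuous u) {ψ : ℝ → ℂ}
    (hc : Continuous ψ) (hs : HasCompactSupport ψ) (ξ₀ v : ℝ) :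
    Tendsto (fun k : ℕ => 𝓕⁻ (fun s => (u (ξ₀ + ((k : ℝ) + 1)⁻¹ * s) : ℂ) * ψ s) v) atTop
      (𝓝 ((u ξ₀ : ℂ) * 𝓕⁻ ψ v)) := by
  obtain ⟨R, hR⟩ := hs.isCompact.isBounded.subset_closedBall 0
  obtain ⟨B, hB⟩ := (isCompact_closedBall ξ₀ R).exists_bound_of_continuousOn hu.continuousOn
  simp_rw [Real.fourierInv_eq']
  rw [← integral_const_mul]
  refine tendsto_integral_of_dominated_convergence (fun s => B * ‖ψ s‖) (fun k => ?_) ?_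
    (fun k => Eventually.of_forall fun s => ?_) (Eventually.of_forall fun s => ?_)
  · exact Continuous.aestronglyMeasurable (by fun_prop)
  · exact ((hc.integrable_of_hasCompactSupport hs).norm).const_mul B
  · rw [norm_smul, Complex.norm_exp_ofReal_mul_I, one_mul, norm_mul, Complex.norm_real]
    rcases eq_or_ne (ψ s) 0 with h | h
    · simp [h]
    · refine mul_le_mul_of_nonneg_right (hB _ ?_) (norm_nonneg _)
      have h1 := hR (subset_tsupport _ h)
      rw [mem_closedBall_zero_iff] at h1
      rw [mem_closedBall_iff_norm, add_sub_cancel_left, norm_mul]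
      refine (mul_le_of_le_one_left (norm_nonneg _) ?_).trans h1
      rw [Real.norm_of_nonneg (by positivity)]
      exact inv_le_one_of_one_le₀ (by simp)
  · have h1 : Tendsto (fun k : ℕ => ξ₀ + ((k : ℝ) + 1)⁻¹ * s) atTop (𝓝 ξ₀) := by
      have := ((tendsto_one_div_add_atTop_nhds_zero_nat (𝕜 := ℝ)).mul_const s).const_add ξ₀
      simpa [one_div] using this
    have h2 : Tendsto (fun k : ℕ => (u (ξ₀ + ((k : ℝ) + 1)⁻¹ * s) : ℂ)) atTop (𝓝 (u ξ₀ : ℂ)) :=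
      (Complex.continuous_ofReal.tendsto _).comp ((hu.tendsto _).comp h1)
    have h3 := (h2.mul_const (ψ s)).const_smul
      (Complex.exp (((2 * Real.pi * inner ℝ s v : ℝ) : ℂ) * Complex.I))
    rwa [smul_eq_mul, mul_left_comm, ← smul_eq_mul (_ : ℂ) (ψ s)] at h3

open FourierTransform in
theorem eLpNorm_fourierInv_ne_zero {ψ : ℝ → ℂ} (hc : Continuous ψ) (hs : HasCompactSupport ψ)
    (h0 : ψ ≠ 0) {p : ℝ≥0∞} (hp : p ≠ 0) : eLpNorm (𝓕⁻ ψ) p volume ≠ 0 := by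
  have hi := hc.integrable_of_hasCompactSupport (μ := (volume : Measure ℝ)) hs
  have h2 : MemLp ψ 2 volume := hc.memLp_of_hasCompactSupport hs
  intro h
  have hm := (continuous_fourierInv hi).aestronglyMeasurable (μ := (volume : Measure ℝ))
  have h3 := eLpNorm_fourierInv hi h2
  rw [(eLpNorm_eq_zero_iff hm (by norm_num)).2 ((eLpNorm_eq_zero_iff hm hp).1 h), eq_comm,
    eLpNorm_eq_zero_iff h2.1 (by norm_num)] at h3
  exact h0 ((hc.ae_eq_iff_eq volume continuous_zero).1 h3)

open FourierTransform in
theorem memLp_fourierInv_of_contDiff {ψ : ℝ → ℂ} (hc : ContDiff ℝ ((⊤ : ℕ∞) : WithTop ℕ∞) ψ)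
    (hs : HasCompactSupport ψ) (p : ℝ≥0∞) : MemLp (𝓕⁻ ψ) p volume := by
  have := (𝓕⁻ (hs.toSchwartzMap hc)).memLp p (volume : Measure ℝ)
  rwa [SchwartzMap.fourierInv_coe] at this

/-! ### Unboundedness of the multipliers -/

open FourierTransform in
/-- A bound for the projection in `L^p` bounds the multipliers of which it is made: apply it to
functions whose Fourier transform concentrates at `ξ₀` and use Fatou's lemma. -/
theorem multiplier_le_of_bounded (ha : 0 < a) (hρ : 0 < ρ) [(M a ρ 2).HasOrthogonalProjection]
    {p : ℝ≥0∞} (hp1 : 1 ≤ p) (hp : p ≠ ⊤) {C : ℝ≥0}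
    (hC : ∀ f : Lp ℂ 2 (omega a ρ), MemLp f p (omega a ρ) →
      eLpNorm ((M a ρ 2).starProjection f) p (omega a ρ) ≤ C * eLpNorm f p (omega a ρ))
    (n m : ℕ) (ξ₀ : ℝ) :
    ENNReal.ofReal (a ^ m / (m.factorial : ℝ)) ^ (1 / p).toReal *
      ENNReal.ofReal (a ^ n / (n.factorial : ℝ) *
        Real.exp (-(a * Real.exp (2 * Real.pi * ρ * ξ₀))) *
        Real.exp (2 * Real.pi * (ρ * (m : ℝ) / 2 + ρ * (n : ℝ) / 2) * ξ₀)) ≤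
      C * ENNReal.ofReal (a ^ n / (n.factorial : ℝ)) ^ (1 / p).toReal := by
  have hp0 : p ≠ 0 := (zero_lt_one.trans_le hp1).ne'
  set u : ℝ → ℝ := fun ξ => a ^ n / (n.factorial : ℝ) *
        Real.exp (-(a * Real.exp (2 * Real.pi * ρ * ξ))) *
        Real.exp (2 * Real.pi * (ρ * (m : ℝ) / 2 + ρ * (n : ℝ) / 2) * ξ) with hu
  have huc : Continuous u := by fun_prop
  have hu0 : 0 ≤ u ξ₀ := by positivity
  obtain ⟨b⟩ : Nonempty (ContDiffBump (0 : ℝ)) := inferInstance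
  set ψ : ℝ → ℂ := fun ξ => (b ξ : ℂ) with hψ
  have hψd : ContDiff ℝ ((⊤ : ℕ∞) : WithTop ℕ∞) ψ := Complex.ofRealCLM.contDiff.comp b.contDiff
  have hψs : HasCompactSupport ψ :=
    b.hasCompactSupport.comp_left (g := fun x : ℝ => (x : ℂ)) rfl
  have hψ0 : ψ ≠ 0 := fun h => by
    have h1 := congrFun h 0
    have h2 : b 0 = 1 := b.one_of_mem_closedBall (Metric.mem_closedBall_self b.rIn_pos.le)
    simp [hψ, h2] at h1
  set A := eLpNorm (𝓕⁻ ψ) p volume with hA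
  have hA0 : A ≠ 0 := eLpNorm_fourierInv_ne_zero hψd.continuous hψs hψ0 hp0
  have hAt : A ≠ ⊤ := (memLp_fourierInv_of_contDiff hψd hψs p).eLpNorm_ne_top
  set cm := ENNReal.ofReal (a ^ m / (m.factorial : ℝ)) ^ (1 / p).toReal with hcm
  set cn := ENNReal.ofReal (a ^ n / (n.factorial : ℝ)) ^ (1 / p).toReal with hcn
  have hcm0 : cm ≠ 0 := (ENNReal.rpow_pos (pos_iff_ne_zero.2 (ofReal_coeff_ne_zero ha m))
    ENNReal.ofReal_ne_top).ne'
  have hcmt : cm ≠ ⊤ := ENNReal.rpow_ne_top_of_nonneg ENNReal.toReal_nonneg ENNReal.ofReal_ne_top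
  -- the functions `h k` are the profiles, at scale `1 / (k + 1)`, of the image under the multiplier
  set h : ℕ → ℝ → ℂ := fun k s => (u (ξ₀ + ((k : ℝ) + 1)⁻¹ * s) : ℂ) * ψ s with hh
  have hstep : ∀ k, eLpNorm (𝓕⁻ (h k)) p volume ≤ cm⁻¹ * (C * (cn * A)) := by
    intro k
    have hr : 0 < (k : ℝ) + 1 := by positivity
    obtain ⟨K, hK0, hKt, hK⟩ := exists_eLpNorm_fourierInv_rescale hp ξ₀ hr
    set φ : ℝ → ℂ := fun ξ => ψ (((k : ℝ) + 1) * (ξ - ξ₀)) with hφ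
    have hφd : ContDiff ℝ ((⊤ : ℕ∞) : WithTop ℕ∞) φ := hψd.comp (by fun_prop)
    have hφs : HasCompactSupport φ := hψs.comp_homeomorph
      ((Homeomorph.subRight ξ₀).trans (Homeomorph.mulLeft₀ ((k : ℝ) + 1) hr.ne'))
    have hφt := memLp_tilt_of_hasCompactSupport hφd.continuous hφs
    have hφi := hφd.continuous.integrable_of_hasCompactSupport (μ := (volume : Measure ℝ)) hφs
    have hmeas : Measurable (𝓕⁻ φ) := (continuous_fourierInv hφi).measurable
    have hF2 : MemLp (onLineOnly (ρ * (n : ℝ) / 2) (𝓕⁻ φ)) 2 (omega a ρ) :=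
      memLp_onLineOnly hρ (by norm_num) (by norm_num) n hmeas
        (memLp_fourierInv_of_contDiff hφd hφs 2)
    have hFp : MemLp (onLineOnly (ρ * (n : ℝ) / 2) (𝓕⁻ φ)) p (omega a ρ) :=
      memLp_onLineOnly hρ hp0 hp n hmeas (memLp_fourierInv_of_contDiff hφd hφs p)
    set f : Lp ℂ 2 (omega a ρ) := hF2.toLp _ with hf
    have hfr : ∀ j, restrictLine ρ ha j f = if j = n then 𝓕⁻ ((hφt 0).toLp _) else 0 := by
      intro j
      have hj : ⇑(restrictLine ρ ha j f) =ᵐ[volume]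
          onLine (onLineOnly (ρ * (n : ℝ) / 2) (𝓕⁻ φ)) (ρ * (j : ℝ) / 2) := by
        rw [restrictLine_apply]
        exact (MemLp.coeFn_toLp _).trans ((ae_omega_iff ha).1 hF2.coeFn_toLp j)
      rw [onLine_onLineOnly] at hj
      refine Lp.ext (hj.trans ?_)
      simp only [lines_injective hρ]
      split_ifs
      · have h3 := coeFn_fourierInv_toLp (g := tilt 0 φ) (by rwa [tilt_zero]) (hφt 0)
        refine EventuallyEq.trans ?_ h3.symm
        rw [tilt_zero]
      · exact (Lp.coeFn_zero ℂ 2 volume).symm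
    have hsym : tilt (ρ * (m : ℝ) / 2) (projSymbol a ρ n φ) =
        fun ξ => h k (((k : ℝ) + 1) * (ξ - ξ₀)) := by
      ext ξ
      simp only [hh, hu, projSymbol, tilt, inv_mul_cancel_left₀ hr.ne', add_sub_cancel]
      have e : Real.exp (2 * Real.pi * (ρ * (m : ℝ) / 2 + ρ * (n : ℝ) / 2) * ξ) =
          Real.exp (2 * Real.pi * (ρ * (m : ℝ) / 2) * ξ) *
            Real.exp (2 * Real.pi * (ρ * (n : ℝ) / 2) * ξ) := by
        rw [← Real.exp_add]; congr 1; ring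
      rw [e, Complex.ofReal_mul _ (_ * _), Complex.ofReal_mul (Real.exp _) (Real.exp _)]
      ring
    have h1 := eLpNorm_onLine_le a ρ hp ((M a ρ 2).starProjection f) m
    rw [eLpNorm_congr_ae (onLine_starProjection ha hρ n hφd.continuous hφs hfr m), hsym, hK] at h1
    have h2 := h1.trans (hC f ((memLp_congr_ae hF2.coeFn_toLp).2 hFp))
    rw [eLpNorm_congr_ae hF2.coeFn_toLp, eLpNorm_onLineOnly hρ hp0 hp, hφ, hK, ← hA, ← hcn,
      ← hcm] at h2
    rw [← ENNReal.mul_le_iff_le_inv hcm0 hcmt, ← ENNReal.mul_le_mul_iff_right hK0 hKt]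
    calc K * (cm * eLpNorm (𝓕⁻ (h k)) p volume) = cm * (K * eLpNorm (𝓕⁻ (h k)) p volume) := by ring
      _ ≤ C * (cn * (K * A)) := h2
      _ = K * (C * (cn * A)) := by ring
  have hhm : ∀ k, AEStronglyMeasurable (𝓕⁻ (h k)) volume := fun k => by
    refine (continuous_fourierInv (Continuous.integrable_of_hasCompactSupport ?_
      hψs.mul_left)).aestronglyMeasurable
    have := hψd.continuous
    fun_prop
  have hfatou := Lp.eLpNorm_lim_le_liminf_eLpNorm (p := p) hhm (fun v => (u ξ₀ : ℂ) * 𝓕⁻ ψ v)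
    (Eventually.of_forall fun v => tendsto_fourierInv_concentrate huc hψd.continuous hψs ξ₀ v)
  have hle : eLpNorm (fun v => (u ξ₀ : ℂ) * 𝓕⁻ ψ v) p volume ≤ cm⁻¹ * (C * (cn * A)) :=
    hfatou.trans (liminf_le_of_le (by isBoundedDefault) fun b hb => by
      obtain ⟨k, hk⟩ := hb.exists
      exact hk.trans (hstep k))
  have hsmul : eLpNorm (fun v => (u ξ₀ : ℂ) * 𝓕⁻ ψ v) p volume = ENNReal.ofReal (u ξ₀) * A := by
    have := eLpNorm_const_smul (u ξ₀ : ℂ) (𝓕⁻ ψ) p (volume : Measure ℝ)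
    rw [← ofReal_norm, Complex.norm_real, Real.norm_of_nonneg hu0] at this
    exact this
  rw [hsmul, ← ENNReal.mul_le_iff_le_inv hcm0 hcmt] at hle
  rw [← ENNReal.mul_le_mul_iff_left hA0 hAt]
  calc cm * ENNReal.ofReal (u ξ₀) * A = cm * (ENNReal.ofReal (u ξ₀) * A) := by ring
    _ ≤ C * (cn * A) := hle
    _ = C * cn * A := by ring

/-- Since `N! ≤ N ^ N`, the left-hand side grows at least like `(c N ^ (1 / 2 - θ)) ^ N`. -/
theorem exists_lt_coeff_rpow_mul {a : ℝ} (ha : 0 < a) {θ : ℝ} (h0 : 0 ≤ θ) (h1 : θ < 1 / 2)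
    (C : ℝ) : ∃ N : ℕ, 0 < N ∧
      C < (a ^ N / (N.factorial : ℝ)) ^ θ * ((N : ℝ) ^ (1 / 2 : ℝ)) ^ N * Real.exp (-(a * N)) := by
  have hlim : Tendsto (fun N : ℕ => a ^ θ * Real.exp (-a) * (N : ℝ) ^ (1 / 2 - θ)) atTop atTop :=
    ((tendsto_rpow_atTop (sub_pos.2 h1)).comp tendsto_natCast_atTop_atTop).const_mul_atTop
      (by positivity)
  have hpow : Tendsto (fun N : ℕ => (2 : ℝ) ^ N) atTop atTop :=
    tendsto_pow_atTop_atTop_of_one_lt one_lt_two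
  obtain ⟨N, hN2, hNC, hN0⟩ := ((hlim.eventually_ge_atTop 2).and
    ((hpow.eventually_gt_atTop C).and (eventually_gt_atTop 0))).exists
  refine ⟨N, hN0, hNC.trans_le ?_⟩
  have hN : (0 : ℝ) < N := by exact_mod_cast hN0
  have e1 : (a / N) ^ N ≤ a ^ N / (N.factorial : ℝ) := by
    rw [div_pow]
    gcongr
    exact_mod_cast Nat.factorial_le_pow N
  calc (2 : ℝ) ^ N ≤ (a ^ θ * Real.exp (-a) * (N : ℝ) ^ (1 / 2 - θ)) ^ N := by gcongr
    _ = ((a / N) ^ N) ^ θ * ((N : ℝ) ^ (1 / 2 : ℝ)) ^ N * Real.exp (-(a * N)) := by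
        rw [← Real.rpow_natCast (a / N) N, ← Real.rpow_mul (by positivity), mul_comm (N : ℝ) θ,
          Real.rpow_mul (by positivity), Real.rpow_natCast, Real.div_rpow ha.le hN.le,
          Real.rpow_sub hN, mul_comm a N, ← mul_neg, Real.exp_nat_mul, ← mul_pow, ← mul_pow]
        congr 1
        ring
    _ ≤ _ := by gcongr

/-- At the frequency `ξ₀` with `exp (2 π ρ ξ₀) = N` the multipliers between the imaginary axis and
the `N`-th line are unbounded in `N`: from the axis to the line for `p > 2`, and from the line to
the axis for `p < 2`. -/
theorem not_bounded_starProjection (ha : 0 < a) (hρ : 0 < ρ) [(M a ρ 2).HasOrthogonalProjection]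
    {p : ℝ≥0∞} (hp1 : 1 ≤ p) (hp : p ≠ ⊤) (hp2 : p ≠ 2) (C : ℝ≥0) :
    ∃ f : Lp ℂ 2 (omega a ρ), MemLp f p (omega a ρ) ∧
      C * eLpNorm f p (omega a ρ) <
        eLpNorm ((M a ρ 2).starProjection f) p (omega a ρ) := by
  by_contra! hC
  have hkey := multiplier_le_of_bounded ha hρ hp1 hp hC
  have hq1 : 1 ≤ p.toReal := by simpa using ENNReal.toReal_mono hp hp1
  have hθ : (1 / p).toReal = 1 / p.toReal := by rw [ENNReal.toReal_div, ENNReal.toReal_one]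
  rw [hθ] at hkey
  have hexp : ∀ N : ℕ, 0 < N →
      Real.exp (2 * Real.pi * ρ * (Real.log N / (2 * Real.pi * ρ))) = N ∧
      Real.exp (2 * Real.pi * (ρ * (N : ℝ) / 2) * (Real.log N / (2 * Real.pi * ρ))) =
        ((N : ℝ) ^ (1 / 2 : ℝ)) ^ N := fun N hN => by
    have hN' : (0 : ℝ) < N := by exact_mod_cast hN
    have hpi := Real.pi_pos
    constructor
    · rw [mul_div_cancel₀ _ (by positivity), Real.exp_log hN']
    · rw [Real.rpow_def_of_pos hN', ← Real.exp_nat_mul]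
      congr 1
      field_simp
  rcases lt_or_gt_of_ne hp2 with h2 | h2
  · have hq2 : p.toReal < 2 := by
      simpa using (ENNReal.toReal_lt_toReal hp (by norm_num)).2 h2
    obtain ⟨N, hN, hlt⟩ := exists_lt_coeff_rpow_mul ha (θ := 1 - 1 / p.toReal)
      (by rw [sub_nonneg, div_le_one (by linarith)]; exact hq1)
      (by rw [sub_lt_comm]; norm_num; rw [lt_inv_comm₀] <;> linarith) C
    have hk := hkey N 0 (Real.log N / (2 * Real.pi * ρ))
    obtain ⟨e1, e2⟩ := hexp N hN
    rw [Nat.cast_zero, mul_zero, zero_div, zero_add, e1, e2, pow_zero, Nat.factorial_zero,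
      Nat.cast_one, div_one, ENNReal.ofReal_one, ENNReal.one_rpow, one_mul,
      ENNReal.ofReal_rpow_of_pos (by positivity), ← ENNReal.ofReal_coe_nnreal,
      ← ENNReal.ofReal_mul (by positivity), ENNReal.ofReal_le_ofReal_iff (by positivity)] at hk
    have hc : 0 < a ^ N / (N.factorial : ℝ) := by positivity
    rw [Real.rpow_sub hc, Real.rpow_one, div_mul_eq_mul_div, div_mul_eq_mul_div,
      lt_div_iff₀ (by positivity)] at hlt
    linarith
  · have hq2 : 2 < p.toReal := by
      simpa using (ENNReal.toReal_lt_toReal (by norm_num) hp).2 h2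
    obtain ⟨N, hN, hlt⟩ := exists_lt_coeff_rpow_mul ha (θ := 1 / p.toReal) (by positivity)
      (by gcongr) C
    have hk := hkey 0 N (Real.log N / (2 * Real.pi * ρ))
    obtain ⟨e1, e2⟩ := hexp N hN
    rw [Nat.cast_zero, mul_zero, zero_div, add_zero, e1, e2, pow_zero, Nat.factorial_zero,
      Nat.cast_one, div_one, ENNReal.ofReal_one, ENNReal.one_rpow, one_mul, mul_one,
      ENNReal.ofReal_rpow_of_pos (by positivity), ← ENNReal.ofReal_coe_nnreal,
      ← ENNReal.ofReal_mul (by positivity), ENNReal.ofReal_le_ofReal_iff (by positivity)] at hk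
    linarith

end HardyBergman

theorem theorem3p6 (a ρ : ℝ) (ha : 0 < a) (hρ : 0 < ρ) :
    ∃ _ : (HardyBergman.M a ρ 2).HasOrthogonalProjection,
      ∀ p : ℝ≥0∞, 1 ≤ p → p ≠ ⊤ → p ≠ 2 →
        (¬ ∃ C : ℝ≥0, ∀ f : Lp ℂ 2 (HardyBergman.omega a ρ),
            MemLp f p (HardyBergman.omega a ρ) →
              HardyBergman.MemM a ρ p ((HardyBergman.M a ρ 2).starProjection f) ∧
              eLpNorm ((HardyBergman.M a ρ 2).starProjection f) p (HardyBergman.omega a ρ) ≤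
                C * eLpNorm f p (HardyBergman.omega a ρ)) ∧
        (∀ C : ℝ≥0, ∃ f : Lp ℂ 2 (HardyBergman.omega a ρ),
            MemLp f p (HardyBergman.omega a ρ) ∧
              C * eLpNorm f p (HardyBergman.omega a ρ) <
                eLpNorm ((HardyBergman.M a ρ 2).starProjection f) p
                  (HardyBergman.omega a ρ)) := by
  have hproj := HardyBergman.hasOrthogonalProjection_M ha hρ
  refine ⟨hproj, fun p hp1 hp hp2 => ⟨?_, HardyBergman.not_bounded_starProjection ha hρ hp1 hp hp2⟩⟩
  rintro ⟨C, hC⟩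
  obtain ⟨f, hf, hlt⟩ := HardyBergman.not_bounded_starProjection ha hρ hp1 hp hp2 C
  exact hlt.not_ge (hC f hf).2
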